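/- Let $\mathbb{G}$ be a coamenable locally compact quantum group (in the $C^*$-algebraic sense): $A=\mathrm{C}_0(\mathbb{G})$ is a $C^*$-algebra with a nondegenerate coassociative $*$-homomorphism $\Delta\colon A\to M(A\otimes A)$ (spatial tensor product) satisfying the cancellation laws $\overline{\operatorname{span}}\,\Delta(A)(A\otimes 1)=A\otimes A=\overline{\operatorname{span}}\,\Delta(A)(1\otimes A)$, with faithful left and right invariant KMS weights, and there is a bounded counit, i.e. $\epsilon\in A^*$ with $(\epsilon\otimes\mathrm{id})\Delta=\mathrm{id}=(\mathrm{id}\otimes\epsilon)\Delta$. For $\omega,\mu\in A^*$ put $L_\omega(a)=(\omega\otimes\mathrm{id})(\Delta(a))\in A$ $(a\in A)$ and $\omega\star\mu=(\omega\otimes\mu)\circ\Delta$. Let $\omega\in A^*$ be a contractive idempotent, i.e. $\omega\neq 0$, $\omega\star\omega=\omega$ and $\|\omega\|\le 1$. Then: 1. $\mathsf{C}_\omega=L_\omega(A)$ is a ternary ring of operators (TRO), i.e. a norm-closed linear subspace of $A$ such that $ab^*c\in\mathsf{C}_\omega$ for all $a,b,c\in\mathsf{C}_\omega$. 2. $L_\omega\colon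 A\to\mathsf{C}_\omega$ is a TRO conditional expectation, i.e. it is a contractive linear map of $A$ onto $\mathsf{C}_\omega$ with $L_\omega(x)=x$ for $x\in\mathsf{C}_\omega$, and for all $a\in A$ and $x,y\in\mathsf{C}_\omega$ $$L_\omega(ax^*y)=L_\omega(a)x^*y,\qquad L_\omega(xa^*y)=xL_\omega(a)^*y,\qquad L_\omega(xy^*a)=xy^*L_\omega(a).$$ -/

import Mathlib

open scoped TensorProduct ComplexOrder ENNReal

noncomputable section

/-! ### Hilbert space tensor products and the spatial tensor product -/

/-- The Hilbert space tensor product `H ⊗₂ K`. -/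
def HilbertTensor (H K : Type*) [NormedAddCommGroup H] [InnerProductSpace ℂ H]
    [NormedAddCommGroup K] [InnerProductSpace ℂ K] : Type _ :=
  UniformSpace.Completion (H ⊗[ℂ] K)

section Operators

variable {H K : Type*} [NormedAddCommGroup H] [InnerProductSpace ℂ H]
  [NormedAddCommGroup K] [InnerProductSpace ℂ K]

instance : NormedAddCommGroup (HilbertTensor H K) :=
  inferInstanceAs (NormedAddCommGroup (UniformSpace.Completion (H ⊗[ℂ] K)))

instance : InnerProductSpace ℂ (HilbertTensor H K) :=
  inferInstanceAs (InnerProductSpace ℂ (UniformSpace.Completion (H ⊗[ℂ] K)))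

instance : CompleteSpace (HilbertTensor H K) :=
  inferInstanceAs (CompleteSpace (UniformSpace.Completion (H ⊗[ℂ] K)))

/-- The canonical isometric inclusion of the algebraic tensor product. -/
def algIncl : H ⊗[ℂ] K →ₗᵢ[ℂ] HilbertTensor H K :=
  (UniformSpace.Completion.toComplₗᵢ : H ⊗[ℂ] K →ₗᵢ[ℂ] UniformSpace.Completion (H ⊗[ℂ] K))

/-- The elementary tensor `h ⊗ k` in the Hilbert space tensor product. -/
def vecTensor (h : H) (k : K) : HilbertTensor H K := algIncl (h ⊗ₜ[ℂ] k)

/-- The operator `S ⊗ T` on `H ⊗₂ K`, with `(S ⊗ T)(h ⊗ k) = S h ⊗ T k`. -/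
def opTensor (S : H →L[ℂ] H) (T : K →L[ℂ] K) : HilbertTensor H K →L[ℂ] HilbertTensor H K :=
  (TensorProduct.mapL S T).completion

lemma opTensor_vecTensor (S : H →L[ℂ] H) (T : K →L[ℂ] K) (h : H) (k : K) :
    opTensor S T (vecTensor h k) = vecTensor (S h) (T k) :=
  ContinuousLinearMap.completion_apply_coe (TensorProduct.mapL S T) (h ⊗ₜ[ℂ] k)

lemma inner_vecTensor (h h' : H) (k k' : K) :
    inner ℂ (vecTensor h k) (vecTensor h' k') = inner ℂ h h' * inner ℂ k k' := by
  simp [vecTensor]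

lemma norm_vecTensor (h : H) (k : K) : ‖vecTensor h k‖ = ‖h‖ * ‖k‖ := by
  simp [vecTensor]

lemma denseRange_algIncl : DenseRange (algIncl : H ⊗[ℂ] K → HilbertTensor H K) :=
  UniformSpace.Completion.denseRange_coe

lemma clm_ext_vecTensor {E : Type*} [NormedAddCommGroup E] [NormedSpace ℂ E]
    {X Y : HilbertTensor H K →L[ℂ] E}
    (hXY : ∀ h k, X (vecTensor h k) = Y (vecTensor h k)) : X = Y := by
  ext z
  refine denseRange_algIncl.induction_on z (isClosed_eq X.continuous Y.continuous) fun t => ?_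
  induction t using TensorProduct.induction_on with
  | zero => simp
  | tmul h k => exact hXY h k
  | add s t hs ht => rw [map_add, map_add, map_add, hs, ht]

lemma opTensor_mul (S S' : H →L[ℂ] H) (T T' : K →L[ℂ] K) :
    opTensor S T * opTensor S' T' = opTensor (S * S') (T * T') :=
  clm_ext_vecTensor fun h k => by simp [opTensor_vecTensor]

lemma opTensor_add_left (S S' : H →L[ℂ] H) (T : K →L[ℂ] K) :
    opTensor (S + S') T = opTensor S T + opTensor S' T :=
  clm_ext_vecTensor fun h k => by
    simp only [opTensor_vecTensor, add_apply]
    simp [vecTensor, TensorProduct.add_tmul]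

lemma opTensor_add_right (S : H →L[ℂ] H) (T T' : K →L[ℂ] K) :
    opTensor S (T + T') = opTensor S T + opTensor S T' :=
  clm_ext_vecTensor fun h k => by
    simp only [opTensor_vecTensor, add_apply]
    simp [vecTensor, TensorProduct.tmul_add]

lemma opTensor_smul_left (c : ℂ) (S : H →L[ℂ] H) (T : K →L[ℂ] K) :
    opTensor (c • S) T = c • opTensor S T :=
  clm_ext_vecTensor fun h k => by
    simp only [opTensor_vecTensor, smul_apply]
    simp [vecTensor, ← TensorProduct.smul_tmul']

lemma opTensor_smul_right (c : ℂ) (S : H →L[ℂ] H) (T : K →L[ℂ] K) :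
    opTensor S (c • T) = c • opTensor S T :=
  clm_ext_vecTensor fun h k => by
    simp only [opTensor_vecTensor, smul_apply]
    simp [vecTensor, TensorProduct.tmul_smul]

lemma star_opTensor [CompleteSpace H] [CompleteSpace K] (S : H →L[ℂ] H) (T : K →L[ℂ] K) :
    star (opTensor S T) = opTensor (star S) (star T) := by
  refine clm_ext_vecTensor fun h k => ?_
  refine ext_inner_left ℂ fun z => ?_
  rw [ContinuousLinearMap.star_eq_adjoint, ContinuousLinearMap.adjoint_inner_right]
  revert z
  suffices hs : ∀ z : HilbertTensor H K,
      inner ℂ (vecTensor h k) (opTensor S T z)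
        = inner ℂ (opTensor (star S) (star T) (vecTensor h k)) z by
    intro z
    rw [← inner_conj_symm, hs, inner_conj_symm]
  have : (innerSL ℂ (vecTensor h k)).comp (opTensor S T)
      = innerSL ℂ (opTensor (star S) (star T) (vecTensor h k)) := by
    refine clm_ext_vecTensor fun h' k' => ?_
    simp [opTensor_vecTensor, inner_vecTensor, ContinuousLinearMap.star_eq_adjoint,
      ContinuousLinearMap.adjoint_inner_left]
  intro z
  exact congrArg (fun f => f z) this

lemma norm_opTensor_one_le (b : H →L[ℂ] H) : ‖opTensor (1 : H →L[ℂ] H) b‖ ≤ ‖b‖ := by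
  have h := TensorProduct.norm_mapL_le (1 : H →L[ℂ] H) b
  refine ContinuousLinearMap.opNorm_le_bound _ (norm_nonneg _) fun z => ?_
  refine denseRange_algIncl.induction_on z (isClosed_le (by fun_prop) (by fun_prop)) fun t => ?_
  have e : opTensor (1 : H →L[ℂ] H) b (algIncl t)
      = algIncl (TensorProduct.mapL (1 : H →L[ℂ] H) b t) :=
    ContinuousLinearMap.completion_apply_coe (TensorProduct.mapL 1 b) t
  rw [e, LinearIsometry.norm_map, LinearIsometry.norm_map]
  refine (ContinuousLinearMap.le_opNorm _ _).trans (mul_le_mul_of_nonneg_right ?_ (norm_nonneg _))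
  refine h.trans (mul_le_of_le_one_left (norm_nonneg _) ContinuousLinearMap.norm_id_le)

/-- The flip unitary of `H ⊗₂ H`. -/
def flipTensor : HilbertTensor H H →L[ℂ] HilbertTensor H H :=
  ((TensorProduct.commIsometry ℂ H H).toContinuousLinearEquiv :
    H ⊗[ℂ] H →L[ℂ] H ⊗[ℂ] H).completion

lemma flipTensor_vecTensor (h k : H) : flipTensor (vecTensor h k) = vecTensor k h :=
  ContinuousLinearMap.completion_apply_coe
    ((TensorProduct.commIsometry ℂ H H).toContinuousLinearEquiv :
      H ⊗[ℂ] H →L[ℂ] H ⊗[ℂ] H) (h ⊗ₜ[ℂ] k)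

lemma flipTensor_mul_self : (flipTensor * flipTensor : HilbertTensor H H →L[ℂ] _) = 1 :=
  clm_ext_vecTensor fun h k => by simp [flipTensor_vecTensor]

lemma flipTensor_opTensor (S T : H →L[ℂ] H) :
    flipTensor * opTensor S T = opTensor T S * flipTensor :=
  clm_ext_vecTensor fun h k => by simp [flipTensor_vecTensor, opTensor_vecTensor]

/-- The isometry (up to the factor `‖k‖`) `h ↦ h ⊗ k`. -/
def rightCreate (k : K) : H →L[ℂ] HilbertTensor H K :=
  LinearMap.mkContinuous
    { toFun := fun h => vecTensor h k
      map_add' := fun h h' => by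
        simp [vecTensor, TensorProduct.add_tmul]
      map_smul' := fun c h => by
        simp [vecTensor, ← TensorProduct.smul_tmul'] }
    ‖k‖ (fun h => (norm_vecTensor h k).trans_le (mul_comm _ _).le)

lemma rightCreate_apply (k : K) (h : H) :
    (rightCreate k : H →L[ℂ] HilbertTensor H K) h = vecTensor h k := rfl

end Operators

section Spatial

variable {A H : Type*} [NonUnitalCStarAlgebra A]
  [NormedAddCommGroup H] [InnerProductSpace ℂ H] [CompleteSpace H]
  (π : A →⋆ₙₐ[ℂ] (H →L[ℂ] H))

/-- The spatial tensor product `A ⊗ A`, realised on `H ⊗₂ H`: the closed linear span of the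
operators `π a ⊗ π b`. -/
def spatialTensor : Submodule ℂ (HilbertTensor H H →L[ℂ] HilbertTensor H H) :=
  (Submodule.span ℂ (Set.range fun p : A × A => opTensor (π p.1) (π p.2))).topologicalClosure

lemma opTensor_mem_spatialTensor (a b : A) : opTensor (π a) (π b) ∈ spatialTensor π :=
  Submodule.le_topologicalClosure _ (Submodule.subset_span ⟨(a, b), rfl⟩)

lemma isClosed_spatialTensor : IsClosed (spatialTensor π : Set (HilbertTensor H H →L[ℂ] HilbertTensor H H)) :=
  Submodule.isClosed_topologicalClosure _

/-- A closed subspace containing all the `π a ⊗ π b`, pulled back along a continuous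
(conjugate-)additive map. -/
lemma spatialTensor_induction {p : (HilbertTensor H H →L[ℂ] HilbertTensor H H) → Prop}
    (hc : IsClosed {x | p x}) (h0 : p 0) (hadd : ∀ x y, p x → p y → p (x + y))
    (hsmul : ∀ (c : ℂ) x, p x → p (c • x)) (hp : ∀ a b, p (opTensor (π a) (π b)))
    {x} (hx : x ∈ spatialTensor π) : p x := by
  have hspan : ∀ y ∈ Submodule.span ℂ (Set.range fun q : A × A => opTensor (π q.1) (π q.2)),
      p y := by
    intro y hy
    induction hy using Submodule.span_induction with
    | mem z hz => obtain ⟨q, rfl⟩ := hz; exact hp _ _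
    | zero => exact h0
    | add u v _ _ hu hv => exact hadd _ _ hu hv
    | smul c u _ hu => exact hsmul _ _ hu
  exact closure_minimal (fun y hy => hspan y hy) hc hx

lemma star_mem_spatialTensor {x} (hx : x ∈ spatialTensor π) : star x ∈ spatialTensor π := by
  refine spatialTensor_induction π (p := fun x => star x ∈ spatialTensor π)
    ((isClosed_spatialTensor π).preimage continuous_star) (by simp)
    (fun x y hx hy => by simpa using add_mem hx hy)
    (fun c x hx => by simpa using Submodule.smul_mem _ (star c) hx) (fun a b => ?_) hx
  rw [star_opTensor, ← map_star, ← map_star]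
  exact opTensor_mem_spatialTensor π _ _

lemma mul_mem_spatialTensor {x y} (hx : x ∈ spatialTensor π) (hy : y ∈ spatialTensor π) :
    x * y ∈ spatialTensor π := by
  refine spatialTensor_induction π (p := fun x => x * y ∈ spatialTensor π)
    ((isClosed_spatialTensor π).preimage (continuous_mul_const y)) (by simp)
    (fun x y hx hy => by simpa [add_mul] using add_mem hx hy)
    (fun c x hx => by simpa using Submodule.smul_mem _ c hx) (fun a b => ?_) hx
  refine spatialTensor_induction π (p := fun y => opTensor (π a) (π b) * y ∈ spatialTensor π)
    ((isClosed_spatialTensor π).preimage (continuous_const_mul _)) (by simp)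
    (fun x y hx hy => by simpa [mul_add] using add_mem hx hy)
    (fun c x hx => by simpa using Submodule.smul_mem _ c hx) (fun a' b' => ?_) hy
  rw [opTensor_mul, ← map_mul, ← map_mul]
  exact opTensor_mem_spatialTensor π _ _

/-- The multiplier algebra `M(A ⊗ A)`, realised on `H ⊗₂ H` as the idealiser of `A ⊗ A`. -/
def multiplierTensor : StarSubalgebra ℂ (HilbertTensor H H →L[ℂ] HilbertTensor H H) where
  carrier := {x | ∀ y ∈ spatialTensor π, x * y ∈ spatialTensor π ∧ y * x ∈ spatialTensor π}
  mul_mem' := fun {x x'} hx hx' y hy => by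
    refine ⟨?_, ?_⟩
    · rw [mul_assoc]; exact (hx _ (hx' y hy).1).1
    · rw [← mul_assoc]; exact (hx' _ (hx y hy).2).2
  add_mem' := fun {x x'} hx hx' y hy => by
    refine ⟨?_, ?_⟩
    · rw [add_mul]; exact add_mem (hx y hy).1 (hx' y hy).1
    · rw [mul_add]; exact add_mem (hx y hy).2 (hx' y hy).2
  algebraMap_mem' := fun c y hy => by
    refine ⟨?_, ?_⟩
    · rw [← Algebra.smul_def]; exact Submodule.smul_mem _ c hy
    · rw [← Algebra.commutes, ← Algebra.smul_def]; exact Submodule.smul_mem _ c hy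
  star_mem' := fun {x} hx y hy => by
    have := hx _ (star_mem_spatialTensor π hy)
    refine ⟨?_, ?_⟩
    · simpa using star_mem_spatialTensor π this.2
    · simpa using star_mem_spatialTensor π this.1

/-- The elementary tensor `a ⊗ b`, as an element of `M(A ⊗ A)`. -/
def tensorElem (a b : A) : multiplierTensor π :=
  ⟨opTensor (π a) (π b), fun _ hy =>
    ⟨mul_mem_spatialTensor π (opTensor_mem_spatialTensor π a b) hy,
      mul_mem_spatialTensor π hy (opTensor_mem_spatialTensor π a b)⟩⟩

end Spatial
/-! ### Slice maps -/

section Slice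

variable {A H : Type*} [NonUnitalCStarAlgebra A]
  [NormedAddCommGroup H] [InnerProductSpace ℂ H] [CompleteSpace H]
  (π : A →⋆ₙₐ[ℂ] (H →L[ℂ] H))

/-- The linear map `a ⊗ b ↦ π a ⊗ π b` from the algebraic to the spatial tensor product. -/
def algTensor : A ⊗[ℂ] A →ₗ[ℂ] spatialTensor π :=
  TensorProduct.lift (LinearMap.mk₂ ℂ
    (fun a b => ⟨opTensor (π a) (π b), opTensor_mem_spatialTensor π a b⟩)
    (fun a a' b => Subtype.ext (by simp [opTensor_add_left]))
    (fun c a b => Subtype.ext (by simp [opTensor_smul_left]))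
    (fun a b b' => Subtype.ext (by simp [opTensor_add_right]))
    (fun c a b => Subtype.ext (by simp [opTensor_smul_right])))

lemma algTensor_tmul (a b : A) :
    (algTensor π (a ⊗ₜ[ℂ] b) : HilbertTensor H H →L[ℂ] HilbertTensor H H)
      = opTensor (π a) (π b) := rfl

lemma denseRange_algTensor : DenseRange (algTensor π) := by
  intro x
  rw [closure_subtype]
  have hx : (x : HilbertTensor H H →L[ℂ] HilbertTensor H H) ∈
    closure (Submodule.span ℂ (Set.range fun p : A × A => opTensor (π p.1) (π p.2)) : Set _) := x.2
  refine closure_mono (fun y hy => ?_) hx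
  have hy' : y ∈ Submodule.map (spatialTensor π).subtype (LinearMap.range (algTensor π)) := by
    refine Submodule.span_le.mpr ?_ hy
    rintro _ ⟨p, rfl⟩
    exact ⟨_, ⟨p.1 ⊗ₜ p.2, rfl⟩, rfl⟩
  obtain ⟨z, ⟨t, rfl⟩, rfl⟩ := hy'
  exact ⟨_, ⟨t, rfl⟩, rfl⟩

/-- The slice map `ω ⊗ id` on the algebraic tensor product, `a ⊗ b ↦ ω(a) b`. -/
def algSlice (ω : A →L[ℂ] ℂ) : A ⊗[ℂ] A →ₗ[ℂ] A :=
  (TensorProduct.lid ℂ A).toLinearMap ∘ₗ LinearMap.rTensor A ω.toLinearMap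

lemma algSlice_tmul (ω : A →L[ℂ] ℂ) (a b : A) : algSlice ω (a ⊗ₜ[ℂ] b) = ω a • b := by
  simp [algSlice]

lemma norm_algSlice_le (hπ : Function.Injective π) (ω : A →L[ℂ] ℂ) (t : A ⊗[ℂ] A) :
    ‖algSlice ω t‖ ≤ ‖ω‖ * ‖algTensor π t‖ := by
  have hiso : ∀ a, ‖π a‖ = ‖a‖ := NonUnitalStarAlgHom.norm_map π hπ
  -- the slices by vector functionals on the second leg
  have hg : ∀ k k' : H, ∃ a : A,
      π a = (rightCreate k').adjoint ∘L (algTensor π t).1 ∘L rightCreate k ∧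
      ω a = inner ℂ k' (π (algSlice ω t) k) := by
    intro k k'
    induction t using TensorProduct.induction_on with
    | zero => exact ⟨0, by simp, by simp⟩
    | tmul a b =>
      refine ⟨inner ℂ k' (π b k) • a, ?_, ?_⟩
      · ext h
        refine ext_inner_left ℂ fun h' => ?_
        simp [ContinuousLinearMap.adjoint_inner_right, rightCreate_apply, algTensor_tmul,
          opTensor_vecTensor, inner_vecTensor, inner_smul_right, mul_comm]
      · simp [algSlice_tmul, mul_comm]
    | add s t hs ht =>
      obtain ⟨a, ha, ha'⟩ := hs
      obtain ⟨b, hb, hb'⟩ := ht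
      refine ⟨a + b, ?_, ?_⟩
      · rw [map_add, ha, hb, map_add]
        ext h
        simp
      · simp [ha', hb']
  have hnc : ∀ k : H, ‖(rightCreate k : H →L[ℂ] HilbertTensor H H)‖ ≤ ‖k‖ := fun k =>
    ContinuousLinearMap.opNorm_le_bound _ (norm_nonneg _)
      (fun h => by rw [rightCreate_apply, norm_vecTensor, mul_comm])
  have hb : ∀ k k' : H, ‖inner ℂ k' (π (algSlice ω t) k)‖ ≤
      ‖ω‖ * ‖algTensor π t‖ * ‖k‖ * ‖k'‖ := by
    intro k k'
    obtain ⟨a, ha, ha'⟩ := hg k k'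
    have h1 : ‖a‖ ≤ ‖k'‖ * (‖algTensor π t‖ * ‖k‖) := by
      rw [← hiso, ha]
      refine (ContinuousLinearMap.opNorm_comp_le _ _).trans ?_
      refine mul_le_mul ?_ ((ContinuousLinearMap.opNorm_comp_le _ _).trans ?_)
        (norm_nonneg _) (norm_nonneg _)
      · rw [LinearIsometryEquiv.norm_map]; exact hnc k'
      · exact mul_le_mul_of_nonneg_left (hnc k) (norm_nonneg _)
    calc ‖inner ℂ k' (π (algSlice ω t) k)‖ = ‖ω a‖ := by rw [ha']
      _ ≤ ‖ω‖ * ‖a‖ := ω.le_opNorm a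
      _ ≤ ‖ω‖ * (‖k'‖ * (‖algTensor π t‖ * ‖k‖)) :=
        mul_le_mul_of_nonneg_left h1 (norm_nonneg _)
      _ = _ := by ring
  rw [← hiso]
  refine ContinuousLinearMap.opNorm_le_bound _ (by positivity) fun k => ?_
  have h2 := hb k (π (algSlice ω t) k)
  rw [inner_self_eq_norm_sq_to_K] at h2
  rcases eq_or_lt_of_le (norm_nonneg (π (algSlice ω t) k)) with h0 | h0
  · rw [← h0]; positivity
  · have : ‖π (algSlice ω t) k‖ * ‖π (algSlice ω t) k‖ ≤
        (‖ω‖ * ‖algTensor π t‖ * ‖k‖) * ‖π (algSlice ω t) k‖ := by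
      simpa [sq] using h2
    exact le_of_mul_le_mul_right this h0

/-- The slice map `ω ⊗ id : A ⊗ A → A`, the bounded linear map with `a ⊗ b ↦ ω(a) b`. -/
def slice (ω : A →L[ℂ] ℂ) : spatialTensor π →L[ℂ] A :=
  (algSlice ω).extendOfNorm (algTensor π)

lemma slice_algTensor (hπ : Function.Injective π) (ω : A →L[ℂ] ℂ) (t : A ⊗[ℂ] A) :
    slice π ω (algTensor π t) = algSlice ω t :=
  LinearMap.extendOfNorm_eq (denseRange_algTensor π) ⟨_, norm_algSlice_le π hπ ω⟩ t

lemma slice_tmul (hπ : Function.Injective π) (ω : A →L[ℂ] ℂ) (a b : A) :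
    slice π ω ⟨opTensor (π a) (π b), opTensor_mem_spatialTensor π a b⟩ = ω a • b :=
  (slice_algTensor π hπ ω (a ⊗ₜ b)).trans (algSlice_tmul ω a b)

lemma norm_slice_le (hπ : Function.Injective π) (ω : A →L[ℂ] ℂ) (x : spatialTensor π) :
    ‖slice π ω x‖ ≤ ‖ω‖ * ‖x‖ :=
  LinearMap.norm_extendOfNorm_apply_le (denseRange_algTensor π) _ (norm_algSlice_le π hπ ω) x

lemma slice_sub (hπ : Function.Injective π) (ω ω' : A →L[ℂ] ℂ) (x : spatialTensor π) :
    slice π (ω - ω') x = slice π ω x - slice π ω' x := by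
  refine (denseRange_algTensor π).induction_on x
    (isClosed_eq (by fun_prop) (by fun_prop)) fun t => ?_
  rw [slice_algTensor π hπ, slice_algTensor π hπ, slice_algTensor π hπ]
  induction t using TensorProduct.induction_on with
  | zero => simp
  | tmul a b => simp [algSlice_tmul, sub_smul]
  | add s t hs ht => rw [map_add, map_add, map_add, hs, ht]; abel

lemma mul_one_opTensor_mem {y} (hy : y ∈ spatialTensor π) (b : A) :
    y * opTensor 1 (π b) ∈ spatialTensor π := by
  refine spatialTensor_induction π (p := fun y => y * opTensor 1 (π b) ∈ spatialTensor π)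
    ((isClosed_spatialTensor π).preimage (continuous_mul_const _)) (by simp)
    (fun x y hx hy => by simpa [add_mul] using add_mem hx hy)
    (fun c x hx => by simpa using Submodule.smul_mem _ c hx) (fun a b' => ?_) hy
  rw [opTensor_mul, ← map_mul, mul_one]
  exact opTensor_mem_spatialTensor π _ _

lemma mul_opTensor_one_mem {y} (hy : y ∈ spatialTensor π) (e : A) :
    y * opTensor (π e) 1 ∈ spatialTensor π := by
  refine spatialTensor_induction π (p := fun y => y * opTensor (π e) 1 ∈ spatialTensor π)
    ((isClosed_spatialTensor π).preimage (continuous_mul_const _)) (by simp)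
    (fun x y hx hy => by simpa [add_mul] using add_mem hx hy)
    (fun c x hx => by simpa using Submodule.smul_mem _ c hx) (fun a b' => ?_) hy
  rw [opTensor_mul, ← map_mul, mul_one]
  exact opTensor_mem_spatialTensor π _ _

lemma slice_mul_right (hπ : Function.Injective π) (ω : A →L[ℂ] ℂ) (y : spatialTensor π) (b : A) :
    slice π ω ⟨y.1 * opTensor 1 (π b), mul_one_opTensor_mem π y.2 b⟩ = slice π ω y * b := by
  refine (denseRange_algTensor π).induction_on y (isClosed_eq ?_ (by fun_prop)) fun t => ?_
  · exact (slice π ω).continuous.comp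
      (Continuous.subtype_mk (continuous_subtype_val.mul_const _) _)
  · induction t using TensorProduct.induction_on with
    | zero =>
      simp only [map_zero, ZeroMemClass.coe_zero, zero_mul]
      exact map_zero (slice π ω)
    | tmul a b' =>
      have : (⟨(algTensor π (a ⊗ₜ b')).1 * opTensor 1 (π b),
          mul_one_opTensor_mem π (algTensor π (a ⊗ₜ b')).2 b⟩ : spatialTensor π)
          = algTensor π (a ⊗ₜ (b' * b)) :=
        Subtype.ext (by simp [algTensor_tmul, opTensor_mul])
      rw [this, slice_algTensor π hπ, slice_algTensor π hπ, algSlice_tmul, algSlice_tmul,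
        smul_mul_assoc]
    | add s t hs ht =>
      have e : (⟨(algTensor π (s + t)).1 * opTensor 1 (π b),
          mul_one_opTensor_mem π (algTensor π (s + t)).2 b⟩ : spatialTensor π)
          = ⟨(algTensor π s).1 * opTensor 1 (π b), mul_one_opTensor_mem π (algTensor π s).2 b⟩
            + ⟨(algTensor π t).1 * opTensor 1 (π b),
              mul_one_opTensor_mem π (algTensor π t).2 b⟩ :=
        Subtype.ext (by rw [map_add]; exact add_mul _ _ _)
      rw [e, map_add, hs, ht, map_add, map_add, add_mul]

/-- The functional `a ↦ ω(a e)`. -/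
def mulFunctional (ω : A →L[ℂ] ℂ) (e : A) : A →L[ℂ] ℂ :=
  ω ∘L (ContinuousLinearMap.mul ℂ A).flip e

lemma mulFunctional_apply (ω : A →L[ℂ] ℂ) (e a : A) : mulFunctional ω e a = ω (a * e) := rfl

lemma slice_mul_left (hπ : Function.Injective π) (ω : A →L[ℂ] ℂ) (y : spatialTensor π) (e : A) :
    slice π ω ⟨y.1 * opTensor (π e) 1, mul_opTensor_one_mem π y.2 e⟩
      = slice π (mulFunctional ω e) y := by
  refine (denseRange_algTensor π).induction_on y (isClosed_eq ?_ (by fun_prop)) fun t => ?_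
  · exact (slice π ω).continuous.comp
      (Continuous.subtype_mk (continuous_subtype_val.mul_const _) _)
  · induction t using TensorProduct.induction_on with
    | zero =>
      simp only [map_zero, ZeroMemClass.coe_zero, zero_mul]
      exact map_zero (slice π ω)
    | tmul a b' =>
      have : (⟨(algTensor π (a ⊗ₜ b')).1 * opTensor (π e) 1,
          mul_opTensor_one_mem π (algTensor π (a ⊗ₜ b')).2 e⟩ : spatialTensor π)
          = algTensor π ((a * e) ⊗ₜ b') :=
        Subtype.ext (by simp [algTensor_tmul, opTensor_mul])
      rw [this, slice_algTensor π hπ, slice_algTensor π hπ, algSlice_tmul, algSlice_tmul,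
        mulFunctional_apply]
    | add s t hs ht =>
      have h : (⟨(algTensor π (s + t)).1 * opTensor (π e) 1,
          mul_opTensor_one_mem π (algTensor π (s + t)).2 e⟩ : spatialTensor π)
          = ⟨(algTensor π s).1 * opTensor (π e) 1, mul_opTensor_one_mem π (algTensor π s).2 e⟩
            + ⟨(algTensor π t).1 * opTensor (π e) 1,
              mul_opTensor_one_mem π (algTensor π t).2 e⟩ :=
        Subtype.ext (by rw [map_add]; exact add_mul _ _ _)
      rw [h, map_add, hs, ht, map_add, map_add]

end Slice
section SliceAux

variable {A H : Type*} [NonUnitalCStarAlgebra A]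
  [NormedAddCommGroup H] [InnerProductSpace ℂ H] [CompleteSpace H]
  (π : A →⋆ₙₐ[ℂ] (H →L[ℂ] H))

lemma norm_row_le (hπ : Function.Injective π) {a b g : A} (ha : ‖a‖ ≤ 1) (hb : ‖b‖ ≤ 1)
    (hg : ‖g‖ ≤ 1) {t : ℝ} (ht : 0 ≤ t) :
    ‖a * (star g * g) + (t : ℂ) • (b - b * (star g * g))‖ ≤ 1 + t ^ 2 / 2 := by
  have hiso : ∀ a, ‖π a‖ = ‖a‖ := NonUnitalStarAlgHom.norm_map π hπ
  rw [← hiso]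
  refine ContinuousLinearMap.opNorm_le_bound _ (by positivity) fun h => ?_
  set G := π g with hG
  have hGn : ‖G‖ ≤ 1 := by rw [hG, hiso]; exact hg
  set k := star G (G h) with hk
  have hp : ‖k‖ ≤ ‖G h‖ := by
    refine ((star G).le_opNorm _).trans ?_
    rw [norm_star]
    exact mul_le_of_le_one_left (norm_nonneg _) hGn
  have hre : RCLike.re (inner ℂ h k) = ‖G h‖ ^ 2 := by
    rw [hk, ContinuousLinearMap.star_eq_adjoint, ContinuousLinearMap.adjoint_inner_right]
    exact inner_self_eq_norm_sq (𝕜 := ℂ) (G h)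
  have hq : ‖h - k‖ ^ 2 + ‖k‖ ^ 2 ≤ ‖h‖ ^ 2 := by
    rw [norm_sub_sq (𝕜 := ℂ), hre]
    nlinarith [norm_nonneg k, norm_nonneg (G h)]
  have e : π (a * (star g * g) + (t : ℂ) • (b - b * (star g * g))) h
      = π a k + (t : ℂ) • (π b (h - k)) := by
    rw [map_add, add_apply, map_mul, map_mul, map_star]
    congr 1
    rw [map_smul, smul_apply, map_sub, map_mul, map_mul, map_star, map_sub]
    rfl
  have h1 : ‖π (a * (star g * g) + (t : ℂ) • (b - b * (star g * g))) h‖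
      ≤ ‖k‖ + t * ‖h - k‖ := by
    rw [e]
    refine (norm_add_le _ _).trans (add_le_add ?_ ?_)
    · refine ((π a).le_opNorm _).trans ?_
      rw [hiso]
      exact mul_le_of_le_one_left (norm_nonneg _) ha
    · rw [norm_smul, Complex.norm_real, Real.norm_of_nonneg ht]
      refine mul_le_mul_of_nonneg_left (((π b).le_opNorm _).trans ?_) ht
      rw [hiso]
      exact mul_le_of_le_one_left (norm_nonneg _) hb
  refine h1.trans (abs_le_of_sq_le_sq' ?_ (by positivity)).2
  have h2 : (‖k‖ + t * ‖h - k‖) ^ 2 ≤ (1 + t ^ 2) * (‖h - k‖ ^ 2 + ‖k‖ ^ 2) := by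
    nlinarith [sq_nonneg (t * ‖k‖ - ‖h - k‖)]
  have h3 : (1 + t ^ 2) * (‖h - k‖ ^ 2 + ‖k‖ ^ 2) ≤ (1 + t ^ 2) * ‖h‖ ^ 2 :=
    mul_le_mul_of_nonneg_left hq (by positivity)
  have h4 : (1 + t ^ 2) * ‖h‖ ^ 2 ≤ ((1 + t ^ 2 / 2) * ‖h‖) ^ 2 := by
    rw [mul_pow]
    exact mul_le_mul_of_nonneg_right (by nlinarith [sq_nonneg (t ^ 2)]) (sq_nonneg _)
  exact h2.trans (h3.trans h4)

/-- The operators `x` on `H ⊗₂ H` for which `x (e ⊗ 1)` and `x (1 ⊗ b)` lie in `A ⊗ A`. -/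
structure IsSliceable (x : HilbertTensor H H →L[ℂ] HilbertTensor H H) : Prop where
  left_mem : ∀ e : A, x * opTensor (π e) 1 ∈ spatialTensor π
  right_mem : ∀ b : A, x * opTensor 1 (π b) ∈ spatialTensor π

/-- `c = (ω ⊗ id)(x)`: the slice map extends to multipliers by `(ω ⊗ id)(x) b = (ω ⊗ id)(x (1 ⊗ b))`,
which determines the value of the strict extension at `x`. -/
def IsSliceOf (ω : A →L[ℂ] ℂ) {x : HilbertTensor H H →L[ℂ] HilbertTensor H H}
    (hx : IsSliceable π x) (c : A) : Prop :=
  ∀ b : A, c * b = slice π ω ⟨x * opTensor 1 (π b), hx.right_mem b⟩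

lemma eq_of_forall_mul_eq {c c' : A} (h : ∀ b : A, c * b = c' * b) : c = c' := by
  rw [← sub_eq_zero, ← CStarRing.mul_star_self_eq_zero_iff, sub_mul, h, sub_self]

lemma norm_le_of_forall_mul {c : A} {C : ℝ} (hC : 0 ≤ C) (h : ∀ b : A, ‖c * b‖ ≤ C * ‖b‖) :
    ‖c‖ ≤ C := by
  have h1 := h (star c)
  rw [CStarRing.norm_self_mul_star, norm_star] at h1
  rcases eq_or_lt_of_le (norm_nonneg c) with h0 | h0
  · rwa [← h0]
  · exact le_of_mul_le_mul_right h1 h0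

lemma IsSliceable.flip {x : HilbertTensor H H →L[ℂ] HilbertTensor H H} (hx : IsSliceable π x) :
    IsSliceable π (flipTensor * x * flipTensor) := by
  have hmem : ∀ y ∈ spatialTensor π, flipTensor * y * flipTensor ∈ spatialTensor π := by
    intro y hy
    refine spatialTensor_induction π (p := fun y => flipTensor * y * flipTensor ∈ spatialTensor π)
      ((isClosed_spatialTensor π).preimage (by fun_prop)) (by simp)
      (fun x y hx hy => by simpa [add_mul, mul_add] using add_mem hx hy)
      (fun c x hx => by simpa using Submodule.smul_mem _ c hx) (fun a b => ?_) hy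
    rw [flipTensor_opTensor, mul_assoc, flipTensor_mul_self, mul_one]
    exact opTensor_mem_spatialTensor π b a
  refine ⟨fun e => ?_, fun b => ?_⟩
  · have := hmem _ (hx.right_mem e)
    rwa [mul_assoc, mul_assoc, ← flipTensor_opTensor, ← mul_assoc, ← mul_assoc] at this
  · have := hmem _ (hx.left_mem b)
    rwa [mul_assoc, mul_assoc, ← flipTensor_opTensor, ← mul_assoc, ← mul_assoc] at this

end SliceAux

section SliceMultiplier

variable {A H : Type*} [NonUnitalCStarAlgebra A] [PartialOrder A] [StarOrderedRing A]
  [NormedAddCommGroup H] [InnerProductSpace ℂ H] [CompleteSpace H]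
  (π : A →⋆ₙₐ[ℂ] (H →L[ℂ] H))

/-- Every bounded functional `ω` on `A` is a norm limit of functionals `a ↦ ω(a e)`. -/
lemma exists_mulFunctional_near (hπ : Function.Injective π) (ω : A →L[ℂ] ℂ) {ε : ℝ}
    (hε : 0 < ε) : ∃ e : A, ‖mulFunctional ω e - ω‖ ≤ ε := by
  obtain ⟨t, ht, htε⟩ : ∃ t : ℝ, 0 < t ∧ ‖ω‖ * t ≤ ε := by
    refine ⟨ε / (‖ω‖ + 1), by positivity, ?_⟩
    rw [mul_div_assoc', div_le_iff₀ (by positivity)]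
    nlinarith [norm_nonneg ω]
  obtain ⟨δ, hδ, hδε⟩ : ∃ δ : ℝ, 0 < δ ∧ 4 * δ ≤ ε * t := ⟨ε * t / 4, by positivity, by linarith⟩
  obtain ⟨a, ha, haω⟩ : ∃ a : A, ‖a‖ < 1 ∧ ‖ω‖ - δ < ‖ω a‖ :=
    ω.exists_lt_apply_of_lt_opNorm (by linarith)
  have hl := CStarAlgebra.increasingApproximateUnit A
  have hlim : Filter.Tendsto (fun f => ‖ω (a * f)‖) (CStarAlgebra.approximateUnit A)
      (nhds ‖ω a‖) :=
    ((ω.continuous.tendsto a).comp (hl.tendsto_mul_left a)).norm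
  obtain ⟨f, hf, hf0, hf1⟩ := ((hlim.eventually (lt_mem_nhds haω)).and
    (hl.eventually_nonneg.and hl.eventually_norm)).exists
  obtain ⟨g, rfl⟩ := (CStarAlgebra.nonneg_iff_eq_star_mul_self).mp hf0
  have hg : ‖g‖ ≤ 1 := by
    rw [CStarRing.norm_star_mul_self] at hf1
    nlinarith [norm_nonneg g]
  have key : ∀ b : A, ‖b‖ ≤ 1 → ‖ω (b - b * (star g * g))‖ ≤ ε := by
    intro b hb
    have hphase : ∀ z : ℂ, ∃ c : ℂ, ‖c‖ ≤ 1 ∧ c * z = ‖z‖ := by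
      intro z
      rcases eq_or_ne z 0 with rfl | hz
      · exact ⟨0, by simp, by simp⟩
      · refine ⟨(‖z‖ : ℂ) / z, ?_, ?_⟩
        · rw [norm_div, Complex.norm_real, norm_norm, div_self (norm_ne_zero_iff.mpr hz)]
        · field_simp
    obtain ⟨c, hc, hcz⟩ := hphase (ω (a * (star g * g)))
    obtain ⟨d, hd, hdz⟩ := hphase (ω (b - b * (star g * g)))
    have h1 := norm_row_le π hπ (a := c • a) (b := d • b) (g := g)
      (by rw [norm_smul]; exact mul_le_one₀ hc (norm_nonneg _) ha.le)
      (by rw [norm_smul]; exact mul_le_one₀ hd (norm_nonneg _) hb) hg ht.le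
    have h2 : ω (c • a * (star g * g) + (t : ℂ) • (d • b - d • b * (star g * g)))
        = ((‖ω (a * (star g * g))‖ + t * ‖ω (b - b * (star g * g))‖ : ℝ) : ℂ) := by
      rw [map_add, smul_mul_assoc, smul_mul_assoc, ← smul_sub, map_smul, map_smul, map_smul,
        smul_eq_mul, smul_eq_mul, smul_eq_mul, hcz, hdz]
      push_cast
      rfl
    have h3 := ω.le_opNorm (c • a * (star g * g) + (t : ℂ) • (d • b - d • b * (star g * g)))
    rw [h2, Complex.norm_real, Real.norm_of_nonneg (by positivity)] at h3
    have h4 := h3.trans (mul_le_mul_of_nonneg_left h1 (norm_nonneg ω))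
    have h5 : t * ‖ω (b - b * (star g * g))‖ ≤ t * ε := by nlinarith
    exact le_of_mul_le_mul_left h5 ht
  refine ⟨star g * g, ContinuousLinearMap.opNorm_le_of_unit_norm hε.le fun b hb => ?_⟩
  have := key b hb.le
  rwa [map_sub, norm_sub_rev] at this

lemma exists_isSliceOf (hπ : Function.Injective π) (ω : A →L[ℂ] ℂ)
    {x : HilbertTensor H H →L[ℂ] HilbertTensor H H} (hx : IsSliceable π x) :
    ∃ c : A, IsSliceOf π ω hx c := by
  have hiso : ∀ a, ‖π a‖ = ‖a‖ := NonUnitalStarAlgHom.norm_map π hπ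
  have hB : ∀ b : A, ‖x * opTensor 1 (π b)‖ ≤ ‖x‖ * ‖b‖ := fun b =>
    (norm_mul_le _ _).trans (mul_le_mul_of_nonneg_left
      ((norm_opTensor_one_le _).trans (hiso b).le) (norm_nonneg _))
  -- approximate slices
  have hs : ∀ e b : A, slice π ω ⟨x * opTensor (π e) 1, hx.left_mem e⟩ * b
      = slice π (mulFunctional ω e) ⟨x * opTensor 1 (π b), hx.right_mem b⟩ := by
    intro e b
    rw [← slice_mul_right π hπ, ← slice_mul_left π hπ]
    refine congrArg _ (Subtype.ext ?_)
    simp only [mul_assoc, opTensor_mul, one_mul, mul_one]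
  have hs' : ∀ (ρ : A →L[ℂ] ℂ) (b : A), ‖slice π ρ ⟨x * opTensor 1 (π b), hx.right_mem b⟩‖
      ≤ ‖ρ‖ * ‖x‖ * ‖b‖ := fun ρ b =>
    (norm_slice_le π hπ ρ _).trans (by
      rw [mul_assoc]; exact mul_le_mul_of_nonneg_left (hB b) (norm_nonneg _))
  choose e he using fun n : ℕ => exists_mulFunctional_near π hπ ω (ε := 1 / ((n : ℝ) + 1))
    Nat.one_div_pos_of_nat
  set s : ℕ → A := fun n => slice π ω ⟨x * opTensor (π (e n)) 1, hx.left_mem (e n)⟩ with hsdef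
  have hcl : ∀ n b, ‖s n * b - slice π ω ⟨x * opTensor 1 (π b), hx.right_mem b⟩‖
      ≤ 1 / ((n : ℝ) + 1) * ‖x‖ * ‖b‖ := by
    intro n b
    rw [hsdef, hs, ← slice_sub π hπ]
    refine (hs' _ b).trans ?_
    gcongr
    exact he n
  have hlim0 : Filter.Tendsto (fun n : ℕ => 1 / ((n : ℝ) + 1) * ‖x‖) Filter.atTop (nhds 0) := by
    simpa using tendsto_one_div_add_atTop_nhds_zero_nat.mul_const ‖x‖
  have hcau : CauchySeq s := by
    refine cauchySeq_of_le_tendsto_0 (fun N : ℕ => 2 * (1 / ((N : ℝ) + 1) * ‖x‖)) ?_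
      (by simpa using hlim0.const_mul 2)
    intro n m N hn hm
    rw [dist_eq_norm]
    refine norm_le_of_forall_mul (by positivity) fun b => ?_
    have hmono : ∀ k : ℕ, N ≤ k → 1 / ((k : ℝ) + 1) ≤ 1 / ((N : ℝ) + 1) := fun k hk =>
      Nat.one_div_le_one_div hk
    have e1 : (s n - s m) * b
        = (s n * b - slice π ω ⟨x * opTensor 1 (π b), hx.right_mem b⟩)
          - (s m * b - slice π ω ⟨x * opTensor 1 (π b), hx.right_mem b⟩) := by
      rw [sub_mul]; abel
    have hn' : ‖s n * b - slice π ω ⟨x * opTensor 1 (π b), hx.right_mem b⟩‖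
        ≤ 1 / ((N : ℝ) + 1) * ‖x‖ * ‖b‖ := (hcl n b).trans (by gcongr)
    have hm' : ‖s m * b - slice π ω ⟨x * opTensor 1 (π b), hx.right_mem b⟩‖
        ≤ 1 / ((N : ℝ) + 1) * ‖x‖ * ‖b‖ := (hcl m b).trans (by gcongr)
    rw [e1]
    refine (norm_sub_le _ _).trans ((add_le_add hn' hm').trans (le_of_eq (by ring)))
  obtain ⟨c, hc⟩ := cauchySeq_tendsto_of_complete hcau
  refine ⟨c, fun b => ?_⟩
  have h1 : Filter.Tendsto (fun n => s n * b) Filter.atTop (nhds (c * b)) := hc.mul_const b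
  have h2 : Filter.Tendsto (fun n => s n * b) Filter.atTop
      (nhds (slice π ω ⟨x * opTensor 1 (π b), hx.right_mem b⟩)) := by
    rw [tendsto_iff_norm_sub_tendsto_zero]
    refine squeeze_zero (fun n => norm_nonneg _) (fun n => hcl n b) ?_
    simpa using hlim0.mul_const ‖b‖
  exact tendsto_nhds_unique h1 h2

/-- The slice `(ω ⊗ id)(x) ∈ A` of a multiplier `x` with `x (A ⊗ 1), x (1 ⊗ A) ⊆ A ⊗ A`. -/
def sliceMul (hπ : Function.Injective π) (ω : A →L[ℂ] ℂ)
    (x : HilbertTensor H H →L[ℂ] HilbertTensor H H) (hx : IsSliceable π x) : A :=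
  (exists_isSliceOf π hπ ω hx).choose

lemma sliceMul_mul (hπ : Function.Injective π) (ω : A →L[ℂ] ℂ)
    {x : HilbertTensor H H →L[ℂ] HilbertTensor H H} (hx : IsSliceable π x) (b : A) :
    sliceMul π hπ ω x hx * b = slice π ω ⟨x * opTensor 1 (π b), hx.right_mem b⟩ :=
  (exists_isSliceOf π hπ ω hx).choose_spec b

lemma norm_sliceMul_le (hπ : Function.Injective π) (ω : A →L[ℂ] ℂ)
    {x : HilbertTensor H H →L[ℂ] HilbertTensor H H} (hx : IsSliceable π x) :
    ‖sliceMul π hπ ω x hx‖ ≤ ‖ω‖ * ‖x‖ := by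
  refine norm_le_of_forall_mul (by positivity) fun b => ?_
  rw [sliceMul_mul]
  refine (norm_slice_le π hπ ω _).trans ?_
  rw [mul_assoc]
  refine mul_le_mul_of_nonneg_left
    ((norm_mul_le x (opTensor 1 (π b))).trans ?_) (norm_nonneg _)
  exact mul_le_mul_of_nonneg_left ((norm_opTensor_one_le _).trans
    (NonUnitalStarAlgHom.norm_map π hπ b).le) (norm_nonneg _)

end SliceMultiplier
/-! ### Weights -/

section Weights

variable {A : Type*} [NonUnitalCStarAlgebra A] [PartialOrder A] [StarOrderedRing A]

/-- A norm-continuous one-parameter group of `*`-automorphisms of `A`. -/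
structure IsOneParameterGroup (σ : ℝ → A ≃⋆ₐ[ℂ] A) : Prop where
  map_zero : ∀ a, σ 0 a = a
  map_add : ∀ s t a, σ (s + t) a = σ s (σ t a)
  continuous : ∀ a, Continuous fun t => σ t a

/-- `x ∈ D(σ_{i/2})` and `σ_{i/2}(x) = y`: there is a function on the strip `0 ≤ Im z ≤ 1/2`,
continuous there and analytic in the interior, which extends `t ↦ σ_t(x)` and has the value `y`
at `i/2`. -/
def HalfAnalyticExtension (σ : ℝ → A ≃⋆ₐ[ℂ] A) (x y : A) : Prop :=
  ∃ F : ℂ → A, ContinuousOn F {z | z.im ∈ Set.Icc (0 : ℝ) (1 / 2)} ∧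
    DifferentiableOn ℂ F {z | z.im ∈ Set.Ioo (0 : ℝ) (1 / 2)} ∧
    (∀ t : ℝ, F t = σ t x) ∧ F (Complex.I / 2) = y

/-- A KMS weight on the `C*`-algebra `A`: a nonzero, densely defined, lower semicontinuous weight
on the positive cone which is invariant under a norm-continuous one-parameter group `σ` and
satisfies `φ(x* x) = φ(σ_{i/2}(x) σ_{i/2}(x)*)` for `x ∈ D(σ_{i/2})`.
Only the values of `φ` on the positive cone matter. -/
structure IsKMSWeight (φ : A → ℝ≥0∞) : Prop where
  map_add : ∀ a b, 0 ≤ a → 0 ≤ b → φ (a + b) = φ a + φ b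
  map_smul : ∀ (r : ℝ) (a : A), 0 ≤ r → 0 ≤ a → φ ((r : ℂ) • a) = ENNReal.ofReal r * φ a
  nonzero : ∃ a, 0 ≤ a ∧ φ a ≠ 0
  lowerSemicontinuousOn : LowerSemicontinuousOn φ {a | 0 ≤ a}
  denselyDefined : {a : A | 0 ≤ a} ⊆ closure {a | 0 ≤ a ∧ φ a < ⊤}
  kms : ∃ σ : ℝ → A ≃⋆ₐ[ℂ] A, IsOneParameterGroup σ ∧
    (∀ t a, 0 ≤ a → φ (σ t a) = φ a) ∧
    ∀ x y, HalfAnalyticExtension σ x y → φ (star x * x) = φ (y * star y)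

/-- A weight is faithful if it vanishes on no nonzero positive element. -/
def IsFaithfulWeight (φ : A → ℝ≥0∞) : Prop := ∀ a, 0 ≤ a → φ a = 0 → a = 0

/-- Positive functionals on `A`. -/
def IsPositiveFunctional (ω : A →L[ℂ] ℂ) : Prop := ∀ a, 0 ≤ a → 0 ≤ ω a

end Weights

/-! ### Comultiplications and locally compact quantum groups -/

/-- Coassociativity `(Δ ⊗ id)Δ = (id ⊗ Δ)Δ`. Here `Φ` and `Ψ` are the extensions of `Δ ⊗ id` and
`id ⊗ Δ` to unital `*`-homomorphisms on `M(A ⊗ A)`, which are determined by their values on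
elementary tensors when `Δ` is nondegenerate; the two sides, operators on `(H ⊗₂ H) ⊗₂ H` and
`H ⊗₂ (H ⊗₂ H)`, are identified by comparing their matrix coefficients at elementary tensors. -/
def IsCoassociative {A H : Type*} [NonUnitalCStarAlgebra A]
    [NormedAddCommGroup H] [InnerProductSpace ℂ H] [CompleteSpace H]
    (π : A →⋆ₙₐ[ℂ] (H →L[ℂ] H)) (Δ : A →⋆ₙₐ[ℂ] multiplierTensor π) : Prop :=
  ∃ (Φ : multiplierTensor π →⋆ₐ[ℂ]
        (HilbertTensor (HilbertTensor H H) H →L[ℂ] HilbertTensor (HilbertTensor H H) H))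
    (Ψ : multiplierTensor π →⋆ₐ[ℂ]
        (HilbertTensor H (HilbertTensor H H) →L[ℂ] HilbertTensor H (HilbertTensor H H))),
    (∀ a b, Φ (tensorElem π a b) = opTensor (Δ a).1 (π b)) ∧
    (∀ a b, Ψ (tensorElem π a b) = opTensor (π a) (Δ b).1) ∧
    ∀ a h₁ h₂ h₃ k₁ k₂ k₃,
      inner ℂ (vecTensor (vecTensor h₁ h₂) h₃) (Φ (Δ a) (vecTensor (vecTensor k₁ k₂) k₃)) =
      inner ℂ (vecTensor h₁ (vecTensor h₂ h₃)) (Ψ (Δ a) (vecTensor k₁ (vecTensor k₂ k₃)))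

/-- A comultiplication on the `C*`-algebra `A` satisfying the quantum cancellation laws.
The algebra is represented faithfully and nondegenerately on a Hilbert space `H`, which serves to
realise the spatial tensor product `A ⊗ A` and its multiplier algebra. -/
structure CancellativeComultiplication (A H : Type*) [NonUnitalCStarAlgebra A]
    [NormedAddCommGroup H] [InnerProductSpace ℂ H] [CompleteSpace H] where
  /-- the representation of `A` on `H` -/
  π : A →⋆ₙₐ[ℂ] (H →L[ℂ] H)
  π_injective : Function.Injective π
  π_nondegenerate :
    (Submodule.span ℂ (Set.range fun p : A × H => π p.1 p.2)).topologicalClosure = ⊤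
  /-- the comultiplication `Δ : A → M(A ⊗ A)` -/
  Δ : A →⋆ₙₐ[ℂ] multiplierTensor π
  Δ_nondegenerate : (Submodule.span ℂ (Set.range fun p : A × spatialTensor π =>
    (Δ p.1).1 * p.2.1)).topologicalClosure = spatialTensor π
  coassociative : IsCoassociative π Δ
  cancel_left : (Submodule.span ℂ (Set.range fun p : A × A =>
    (Δ p.1).1 * opTensor (π p.2) 1)).topologicalClosure = spatialTensor π
  cancel_right : (Submodule.span ℂ (Set.range fun p : A × A =>
    (Δ p.1).1 * opTensor 1 (π p.2))).topologicalClosure = spatialTensor π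

namespace CancellativeComultiplication

section Convolution

variable {A H : Type*} [NonUnitalCStarAlgebra A]
  [NormedAddCommGroup H] [InnerProductSpace ℂ H] [CompleteSpace H]
  (G : CancellativeComultiplication A H)

lemma isSliceable (a : A) : IsSliceable G.π (G.Δ a).1 where
  left_mem e := by
    rw [← G.cancel_left]
    exact Submodule.le_topologicalClosure _ (Submodule.subset_span ⟨(a, e), rfl⟩)
  right_mem b := by
    rw [← G.cancel_right]
    exact Submodule.le_topologicalClosure _ (Submodule.subset_span ⟨(a, b), rfl⟩)

lemma norm_comul_le (a : A) : ‖(G.Δ a).1‖ ≤ ‖a‖ :=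
  NonUnitalStarAlgHom.norm_apply_le
    ({ toFun := fun a => (G.Δ a).1
       map_smul' := fun c a => by simp
       map_zero' := by simp
       map_add' := fun a b => by simp
       map_mul' := fun a b => by simp
       map_star' := fun a => by rw [map_star]; rfl } :
      A →⋆ₙₐ[ℂ] (HilbertTensor H H →L[ℂ] HilbertTensor H H)) a

end Convolution

section Convolution

variable {A H : Type*} [NonUnitalCStarAlgebra A] [PartialOrder A] [StarOrderedRing A]
  [NormedAddCommGroup H] [InnerProductSpace ℂ H] [CompleteSpace H]
  (G : CancellativeComultiplication A H)

/-- The left convolution operator `L_ω(a) = (ω ⊗ id)(Δ(a))`. -/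
def leftConv (ω : A →L[ℂ] ℂ) : A →L[ℂ] A :=
  LinearMap.mkContinuous
    { toFun := fun a => sliceMul G.π G.π_injective ω (G.Δ a).1 (G.isSliceable a)
      map_add' := fun a a' => eq_of_forall_mul_eq fun b => by
        rw [add_mul, sliceMul_mul, sliceMul_mul, sliceMul_mul, ← map_add]
        exact congrArg (slice G.π ω) (Subtype.ext (by simp [add_mul]))
      map_smul' := fun c a => eq_of_forall_mul_eq fun b => by
        rw [smul_mul_assoc, sliceMul_mul, sliceMul_mul, RingHom.id_apply, ← map_smul]
        exact congrArg (slice G.π ω) (Subtype.ext (by simp)) }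
    ‖ω‖ (fun a => (norm_sliceMul_le G.π G.π_injective ω (G.isSliceable a)).trans
      (mul_le_mul_of_nonneg_left (G.norm_comul_le a) (norm_nonneg _)))

/-- The right convolution operator `R_ω(a) = (id ⊗ ω)(Δ(a)) = (ω ⊗ id)(flip (Δ(a)))`. -/
def rightConv (ω : A →L[ℂ] ℂ) (a : A) : A :=
  sliceMul G.π G.π_injective ω (flipTensor * (G.Δ a).1 * flipTensor) (G.isSliceable a).flip

/-- The convolution `ω ⋆ μ = (ω ⊗ μ) ∘ Δ = μ ∘ (ω ⊗ id) ∘ Δ`. -/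
def conv (ω μ : A →L[ℂ] ℂ) : A →L[ℂ] ℂ := μ.comp (G.leftConv ω)

/-- Left invariance: `φ((ω ⊗ id)Δ(a)) = ω(1) φ(a)` for positive `ω` and for `a ≥ 0` with
`φ(a) < ∞`; here `ω(1) = ‖ω‖`. -/
def IsLeftInvariant (φ : A → ℝ≥0∞) : Prop :=
  ∀ ω : A →L[ℂ] ℂ, IsPositiveFunctional ω → ∀ a, 0 ≤ a → φ a < ⊤ →
    φ (G.leftConv ω a) = ENNReal.ofReal ‖ω‖ * φ a

/-- Right invariance: `ψ((id ⊗ ω)Δ(a)) = ω(1) ψ(a)` for positive `ω` and for `a ≥ 0` with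
`ψ(a) < ∞`; here `ω(1) = ‖ω‖`. -/
def IsRightInvariant (ψ : A → ℝ≥0∞) : Prop :=
  ∀ ω : A →L[ℂ] ℂ, IsPositiveFunctional ω → ∀ a, 0 ≤ a → ψ a < ⊤ →
    ψ (G.rightConv ω a) = ENNReal.ofReal ‖ω‖ * ψ a

end Convolution

end CancellativeComultiplication

/-- A locally compact quantum group `𝔾` with `A = C₀(𝔾)`: a comultiplication with the quantum
cancellation laws admitting faithful left and right invariant KMS weights. -/
structure LocallyCompactQuantumGroup (A H : Type*) [NonUnitalCStarAlgebra A] [PartialOrder A]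
    [StarOrderedRing A] [NormedAddCommGroup H] [InnerProductSpace ℂ H] [CompleteSpace H]
    extends CancellativeComultiplication A H where
  exists_left_haar : ∃ φ : A → ℝ≥0∞, IsKMSWeight φ ∧ IsFaithfulWeight φ ∧
    toCancellativeComultiplication.IsLeftInvariant φ
  exists_right_haar : ∃ ψ : A → ℝ≥0∞, IsKMSWeight ψ ∧ IsFaithfulWeight ψ ∧
    toCancellativeComultiplication.IsRightInvariant ψ

namespace LocallyCompactQuantumGroup

variable {A H : Type*} [NonUnitalCStarAlgebra A] [PartialOrder A] [StarOrderedRing A]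
  [NormedAddCommGroup H] [InnerProductSpace ℂ H] [CompleteSpace H]
  (G : LocallyCompactQuantumGroup A H)

/-- `𝔾` is coamenable if it admits a bounded counit. -/
def IsCoamenable : Prop :=
  ∃ ε : A →L[ℂ] ℂ, ∀ a, G.leftConv ε a = a ∧ G.rightConv ε a = a

/-- Contractive idempotent functionals in the measure algebra `M(𝔾) = A*`. -/
structure IsContractiveIdempotent (ω : A →L[ℂ] ℂ) : Prop where
  ne_zero : ω ≠ 0
  idempotent : G.conv ω ω = ω
  contractive : ‖ω‖ ≤ 1

/-- The image `C_ω = L_ω(C₀(𝔾))`. -/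
def imageSpace (ω : A →L[ℂ] ℂ) : Submodule ℂ A := LinearMap.range (G.leftConv ω).toLinearMap

end LocallyCompactQuantumGroup

/-! ### Ternary rings of operators -/

section TRO

variable {A : Type*} [NonUnitalCStarAlgebra A]

/-- A subspace of a `C*`-algebra is a ternary ring of operators if it is closed and stable under
the ternary product `a b* c`. (A faithful representation of the `C*`-algebra on a Hilbert space
is isometric, so this says that the image of `X` is a ternary ring of operators on that space.) -/
structure IsTRO (X : Submodule ℂ A) : Prop where
  isClosed : IsClosed (X : Set A)
  ternary_mem : ∀ a ∈ X, ∀ b ∈ X, ∀ c ∈ X, a * star b * c ∈ X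

/-- `P` is a TRO conditional expectation from the `C*`-algebra `A`, viewed as a TRO, onto its
sub-TRO `X`: a contractive projection onto `X` with the ternary module properties. -/
structure IsTROConditionalExpectation (X : Submodule ℂ A) (P : A →ₗ[ℂ] A) : Prop where
  isTRO : IsTRO X
  range_eq : LinearMap.range P = X
  apply_of_mem : ∀ x ∈ X, P x = x
  contractive : ∀ a, ‖P a‖ ≤ ‖a‖
  map_left : ∀ a, ∀ x ∈ X, ∀ y ∈ X, P (a * star x * y) = P a * star x * y
  map_middle : ∀ a, ∀ x ∈ X, ∀ y ∈ X, P (x * star a * y) = x * star (P a) * y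
  map_right : ∀ a, ∀ x ∈ X, ∀ y ∈ X, P (x * star y * a) = x * star y * P a

end TRO

end

noncomputable section

/-! ### Module structure of the spatial tensor product -/

section SpatialModule

variable {A H : Type*} [NonUnitalCStarAlgebra A]
  [NormedAddCommGroup H] [InnerProductSpace ℂ H] [CompleteSpace H]
  (π : A →⋆ₙₐ[ℂ] (H →L[ℂ] H))

/-! The argument replaces `ω` by a positive companion and runs a multiplicative-domain argument for
it. Here `ω` has norm one, and `ω^*` denotes the functional `a ↦ conj ω(a*)`.

A majorant `φ` of `ω` is a positive contraction with `|ω(a)|² ≤ φ(a* a)`. One exists by a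
Hahn–Banach argument (`exists_isMajorant`). If `‖eₙ‖ ≤ 1` and `ω(eₙ) → 1`, then `φ(eₙ* b) → ω(b)`
and `ω(eₙ b) → φ(b)`, so `ω` determines `φ` (`IsMajorant.unique`). The Schur product theorem gives
the Kadison–Schwarz inequality `L_ω(a)* L_ω(a) ≤ L_φ(a* a)`, tested on positive functionals. It
shows that `φ ⋆ φ` is again a majorant of `ω`; by uniqueness `φ` is idempotent too.

Idempotence now forces equality: for `y` in the range of `L_ω`, the Kadison–Schwarz defect at
`Δ(y)(1 ⊗ u)` tends to zero, when tested on `φ`, as `u` runs through an approximate unit.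
Cauchy–Schwarz for the defect form kills the corresponding off-diagonal terms as well, and the
density of `(1 ⊗ A)Δ(A)` turns this into `φ(b L_ω(d)) = ω^*(b) ω(d)` (`majorant_mul_leftConv`).

Coassociativity lifts such scalar identities to operators (`leftConv_mul_leftConv`). The outcome is
`L_φ(b L_ω(a)) = L_ω(b*)* L_ω(a)`, `L_ω(b L_φ(a)) = L_ω(b) L_φ(a)` and `L_ω(L_ω(a) b) = L_ω(a)
L_φ(b)`. Combining them yields the three ternary module identities, and these make the range a TRO.

The other ingredient is `L_μ L_ω = L_{ω ⋆ μ}`. Coassociativity is given through matrix coefficients,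
which settles the case of vector functionals. The passage to arbitrary functionals, which need not
be limits of vector functionals in norm, uses that each `ω` is a norm limit of functionals `ω(· e)`,
and that slicing against these involves only elements of `A ⊗ A`. -/

/-- The elementary tensor `a ⊗ b` in `A ⊗ A`. -/
def elemTensor (a b : A) : spatialTensor π :=
  ⟨opTensor (π a) (π b), opTensor_mem_spatialTensor π a b⟩

/-- No scalar or zero case is needed: algebraic tensors are sums of elementary ones, and zero is the
elementary tensor `0 ⊗ 0`. -/
lemma spatialTensor_induction' {p : spatialTensor π → Prop} (hc : IsClosed {x | p x})
    (hadd : ∀ x y, p x → p y → p (x + y)) (hp : ∀ a b, p (elemTensor π a b))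
    (x : spatialTensor π) : p x := by
  refine (denseRange_algTensor π).induction_on x hc fun t => ?_
  induction t using TensorProduct.induction_on with
  | zero =>
    have : algTensor π 0 = elemTensor π 0 0 := by
      refine Subtype.ext ?_
      have := algTensor_tmul π (0 : A) 0
      rw [TensorProduct.zero_tmul] at this
      exact this
    rw [this]; exact hp _ _
  | tmul a b => exact hp a b
  | add s t hs ht => rw [map_add]; exact hadd _ _ hs ht

lemma spatialTensor_clm_ext {E : Type*} [NormedAddCommGroup E] [NormedSpace ℂ E]
    {X Y : spatialTensor π →L[ℂ] E}
    (h : ∀ a b, X (elemTensor π a b) = Y (elemTensor π a b)) : X = Y :=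
  ContinuousLinearMap.ext fun x => spatialTensor_induction' π
    (p := fun x => X x = Y x) (isClosed_eq X.continuous Y.continuous)
    (fun x y hx hy => by rw [map_add, map_add, hx, hy]) h x

/-- Left multiplication by a multiplier on `A ⊗ A`. -/
def leftMul (X : multiplierTensor π) : spatialTensor π →L[ℂ] spatialTensor π :=
  ((ContinuousLinearMap.mul ℂ _ X.1).comp (spatialTensor π).subtypeL).codRestrict _
    fun y => (X.2 y y.2).1

/-- Right multiplication by a multiplier on `A ⊗ A`. -/
def rightMul (X : multiplierTensor π) : spatialTensor π →L[ℂ] spatialTensor π :=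
  (((ContinuousLinearMap.mul ℂ (HilbertTensor H H →L[ℂ] HilbertTensor H H)).flip X.1).comp (spatialTensor π).subtypeL).codRestrict _
    fun y => (X.2 y y.2).2

@[simp] lemma coe_leftMul (X : multiplierTensor π) (T : spatialTensor π) :
    (leftMul π X T : HilbertTensor H H →L[ℂ] HilbertTensor H H) = X.1 * T.1 := rfl

@[simp] lemma coe_rightMul (X : multiplierTensor π) (T : spatialTensor π) :
    (rightMul π X T : HilbertTensor H H →L[ℂ] HilbertTensor H H) = T.1 * X.1 := rfl

@[simp] lemma coe_elemTensor (a b : A) :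
    (elemTensor π a b : HilbertTensor H H →L[ℂ] HilbertTensor H H) = opTensor (π a) (π b) := rfl

/-- The adjoint of an element of `A ⊗ A`. -/
def adjTensor (T : spatialTensor π) : spatialTensor π := ⟨star T.1, star_mem_spatialTensor π T.2⟩

@[simp] lemma coe_adjTensor (T : spatialTensor π) :
    (adjTensor π T : HilbertTensor H H →L[ℂ] HilbertTensor H H) = star T.1 := rfl

lemma adjTensor_adjTensor (T : spatialTensor π) : adjTensor π (adjTensor π T) = T :=
  Subtype.ext (star_star T.1)

lemma adjTensor_add (S T : spatialTensor π) :
    adjTensor π (S + T) = adjTensor π S + adjTensor π T :=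
  Subtype.ext (star_add S.1 T.1)

lemma adjTensor_smul (c : ℂ) (T : spatialTensor π) :
    adjTensor π (c • T) = star c • adjTensor π T :=
  Subtype.ext (star_smul c T.1)

lemma adjTensor_elemTensor (a b : A) :
    adjTensor π (elemTensor π a b) = elemTensor π (star a) (star b) :=
  Subtype.ext (by simp [star_opTensor, map_star])

lemma continuous_adjTensor : Continuous (adjTensor π) :=
  Continuous.subtype_mk (continuous_star.comp continuous_subtype_val) _

/-- An element of `A ⊗ A`, viewed as a multiplier. -/
def toMultiplier (T : spatialTensor π) : multiplierTensor π :=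
  ⟨T.1, fun _ hy => ⟨mul_mem_spatialTensor π T.2 hy, mul_mem_spatialTensor π hy T.2⟩⟩

@[simp] lemma coe_toMultiplier (T : spatialTensor π) :
    (toMultiplier π T : HilbertTensor H H →L[ℂ] HilbertTensor H H) = T.1 := rfl

lemma toMultiplier_elemTensor (a b : A) :
    toMultiplier π (elemTensor π a b) = tensorElem π a b := rfl

/-- The multiplier `1 ⊗ c`. -/
def oneTensor (c : A) : multiplierTensor π :=
  ⟨opTensor 1 (π c), fun y hy => by
    refine ⟨?_, mul_one_opTensor_mem π hy c⟩
    -- Multiplication on the left reduces to the right: `(1 ⊗ c) y` is the adjoint of `y* (1 ⊗ c*)`.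
    have := star_mem_spatialTensor π
      (mul_one_opTensor_mem π (star_mem_spatialTensor π hy) (star c))
    simpa [star_opTensor, map_star] using this⟩

@[simp] lemma coe_oneTensor (c : A) :
    (oneTensor π c : HilbertTensor H H →L[ℂ] HilbertTensor H H) = opTensor 1 (π c) := rfl

/-- The functional `a ↦ ω(e a)`. -/
def leftMulFunctional (ω : A →L[ℂ] ℂ) (e : A) : A →L[ℂ] ℂ := ω ∘L ContinuousLinearMap.mul ℂ A e

lemma leftMulFunctional_apply (ω : A →L[ℂ] ℂ) (e a : A) : leftMulFunctional ω e a = ω (e * a) := rfl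

/-- The functional `a ↦ conj ω(a*)`. -/
def starFunctional (ω : A →L[ℂ] ℂ) : A →L[ℂ] ℂ :=
  LinearMap.mkContinuous
    { toFun := fun a => star (ω (star a))
      map_add' := fun a b => by simp
      map_smul' := fun c a => by simp }
    ‖ω‖ (fun a => by
      have := ω.le_opNorm (star a)
      rw [norm_star] at this
      simpa using this)

lemma starFunctional_apply (ω : A →L[ℂ] ℂ) (a : A) :
    starFunctional ω a = star (ω (star a)) := rfl

lemma starFunctional_starFunctional (ω : A →L[ℂ] ℂ) :
    starFunctional (starFunctional ω) = ω :=
  ContinuousLinearMap.ext fun a => by simp [starFunctional_apply]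

lemma norm_starFunctional_le (ω : A →L[ℂ] ℂ) : ‖starFunctional ω‖ ≤ ‖ω‖ :=
  LinearMap.mkContinuous_norm_le _ (norm_nonneg _) _

lemma slice_elemTensor (hπ : Function.Injective π) (ω : A →L[ℂ] ℂ) (a b : A) :
    slice π ω (elemTensor π a b) = ω a • b := slice_tmul π hπ ω a b

lemma slice_leftMul_tensorElem (hπ : Function.Injective π) (ω : A →L[ℂ] ℂ) (a c : A) (T : spatialTensor π) :
    slice π ω (leftMul π (tensorElem π a c) T) = c * slice π (leftMulFunctional ω a) T := by
  have : (slice π ω) ∘L leftMul π (tensorElem π a c)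
      = (ContinuousLinearMap.mul ℂ A c) ∘L slice π (leftMulFunctional ω a) := by
    refine spatialTensor_clm_ext π fun a' b' => ?_
    have e : leftMul π (tensorElem π a c) (elemTensor π a' b')
        = elemTensor π (a * a') (c * b') := Subtype.ext (by simp [tensorElem, opTensor_mul])
    simp [e, slice_elemTensor π hπ, leftMulFunctional_apply]
  exact congrArg (fun f => f T) this

lemma slice_leftMul_oneTensor (hπ : Function.Injective π) (ω : A →L[ℂ] ℂ) (c : A) (T : spatialTensor π) :
    slice π ω (leftMul π (oneTensor π c) T) = c * slice π ω T := by
  have : (slice π ω) ∘L leftMul π (oneTensor π c)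
      = (ContinuousLinearMap.mul ℂ A c) ∘L slice π ω := by
    refine spatialTensor_clm_ext π fun a' b' => ?_
    have e : leftMul π (oneTensor π c) (elemTensor π a' b')
        = elemTensor π a' (c * b') := Subtype.ext (by simp [opTensor_mul])
    simp [e, slice_elemTensor π hπ]
  exact congrArg (fun f => f T) this

lemma slice_rightMul_oneTensor (hπ : Function.Injective π) (ω : A →L[ℂ] ℂ) (c : A) (T : spatialTensor π) :
    slice π ω (rightMul π (oneTensor π c) T) = slice π ω T * c :=
  slice_mul_right π hπ ω T c

/-- The right side is a composite of two conjugate-linear maps, so density is invoked by induction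
rather than by comparing bundled linear maps. -/
lemma slice_starFunctional (hπ : Function.Injective π) (ω : A →L[ℂ] ℂ) (T : spatialTensor π) :
    slice π (starFunctional ω) T = star (slice π ω (adjTensor π T)) := by
  refine spatialTensor_induction' π
    (p := fun T => slice π (starFunctional ω) T = star (slice π ω (adjTensor π T)))
    (isClosed_eq (by fun_prop)
      (continuous_star.comp ((slice π ω).continuous.comp (continuous_adjTensor π))))
    (fun x y hx hy => by rw [map_add, hx, hy, adjTensor_add, map_add, star_add])
    (fun a b => ?_) T
  rw [adjTensor_elemTensor, slice_elemTensor π hπ, slice_elemTensor π hπ, starFunctional_apply]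
  simp

lemma slice_add_functional (hπ : Function.Injective π) (ω μ : A →L[ℂ] ℂ) (T : spatialTensor π) :
    slice π (ω + μ) T = slice π ω T + slice π μ T := by
  have : slice π (ω + μ) = slice π ω + slice π μ :=
    spatialTensor_clm_ext π fun a b => by simp [slice_elemTensor π hπ, add_smul]
  rw [this]; rfl

lemma slice_smul_functional (hπ : Function.Injective π) (c : ℂ) (ω : A →L[ℂ] ℂ) (T : spatialTensor π) :
    slice π (c • ω) T = c • slice π ω T := by
  have : slice π (c • ω) = c • slice π ω :=
    spatialTensor_clm_ext π fun a b => by simp [slice_elemTensor π hπ, mul_smul]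
  rw [this]; rfl

end SpatialModule

/-! ### The elements `Δ(a)(1 ⊗ b)` and `(1 ⊗ c)Δ(a)` of `A ⊗ A`. -/

namespace CancellativeComultiplication

section Comultiplication

variable {A H : Type*} [NonUnitalCStarAlgebra A]
  [NormedAddCommGroup H] [InnerProductSpace ℂ H] [CompleteSpace H]
  (G : CancellativeComultiplication A H)

/-- `Δ(a)(1 ⊗ b)`, as an element of `A ⊗ A`. -/
def comulRight (a b : A) : spatialTensor G.π :=
  ⟨(G.Δ a).1 * opTensor 1 (G.π b), (G.isSliceable a).right_mem b⟩

/-- `(1 ⊗ c)Δ(a)`, as an element of `A ⊗ A`. -/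
def comulLeft (c a : A) : spatialTensor G.π := adjTensor G.π (G.comulRight (star a) (star c))

@[simp] lemma coe_comulRight (a b : A) :
    (G.comulRight a b : HilbertTensor H H →L[ℂ] HilbertTensor H H)
      = (G.Δ a).1 * opTensor 1 (G.π b) := rfl

@[simp] lemma coe_comulLeft (c a : A) :
    (G.comulLeft c a : HilbertTensor H H →L[ℂ] HilbertTensor H H)
      = opTensor 1 (G.π c) * (G.Δ a).1 := by
  simp [comulLeft, star_opTensor, map_star]

/-- The elements `(1 ⊗ c)Δ(a)` are total in `A ⊗ A`. -/
lemma comulLeft_induction {p : spatialTensor G.π → Prop} (hc : IsClosed {x | p x})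
    (h0 : p 0) (hadd : ∀ x y, p x → p y → p (x + y)) (hsmul : ∀ (z : ℂ) x, p x → p (z • x))
    (hp : ∀ c a, p (G.comulLeft c a)) (T : spatialTensor G.π) : p T := by
  -- The cancellation law concerns `Δ(a)(1 ⊗ b)`; the adjoint is a homeomorphism that carries these
  -- elements to `(1 ⊗ b*)Δ(a*)`.
  have key : ∀ x (hx : x ∈ spatialTensor G.π), p (adjTensor G.π ⟨x, hx⟩) := by
    intro x hx
    have hx' := hx
    rw [← G.cancel_right] at hx'
    have hsub : ∀ y ∈ Submodule.span ℂ (Set.range fun p : A × A =>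
        (G.Δ p.1).1 * opTensor 1 (G.π p.2)), ∀ hy : y ∈ spatialTensor G.π,
        p (adjTensor G.π ⟨y, hy⟩) := by
      intro y hy
      induction hy using Submodule.span_induction with
      | mem z hz =>
        obtain ⟨q, rfl⟩ := hz
        intro hy
        have := hp (star q.2) (star q.1)
        simp only [comulLeft, star_star] at this
        exact this
      | zero =>
        intro hy
        have : adjTensor G.π ⟨0, hy⟩ = 0 := Subtype.ext (by simp)
        rw [this]; exact h0
      | add u v hu' hv' hu hv =>
        intro hy
        have hspan : ∀ w ∈ Submodule.span ℂ (Set.range fun p : A × A =>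
            (G.Δ p.1).1 * opTensor 1 (G.π p.2)), w ∈ spatialTensor G.π := fun w hw => by
          rw [← G.cancel_right]; exact Submodule.le_topologicalClosure _ hw
        exact (adjTensor_add G.π ⟨u, hspan u hu'⟩ ⟨v, hspan v hv'⟩) ▸
          hadd _ _ (hu (hspan u hu')) (hv (hspan v hv'))
      | smul c u hu' hu =>
        intro hy
        have hspan : u ∈ spatialTensor G.π := by
          rw [← G.cancel_right]; exact Submodule.le_topologicalClosure _ hu'
        exact (adjTensor_smul G.π c ⟨u, hspan⟩) ▸ hsmul _ _ (hu hspan)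
    have hcl : (⟨x, hx⟩ : spatialTensor G.π) ∈
        closure {z : spatialTensor G.π | z.1 ∈ Submodule.span ℂ (Set.range fun p : A × A =>
          (G.Δ p.1).1 * opTensor 1 (G.π p.2))} := by
      rw [closure_subtype]
      refine closure_mono (fun y hy => ?_) hx'
      have hy' : y ∈ spatialTensor G.π := by
        rw [← G.cancel_right]; exact Submodule.le_topologicalClosure _ hy
      exact ⟨⟨y, hy'⟩, hy, rfl⟩
    have hc' : IsClosed {z : spatialTensor G.π | p (adjTensor G.π z)} :=
      hc.preimage (continuous_adjTensor G.π)
    exact closure_minimal (fun z hz => hsub z.1 hz z.2) hc' hcl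
  have := key _ (adjTensor G.π T).2
  rwa [Subtype.coe_eta, adjTensor_adjTensor] at this

lemma clm_ext_comulLeft {E : Type*} [NormedAddCommGroup E] [NormedSpace ℂ E]
    {X Y : spatialTensor G.π →L[ℂ] E}
    (h : ∀ c a, X (G.comulLeft c a) = Y (G.comulLeft c a)) : X = Y :=
  ContinuousLinearMap.ext fun x => G.comulLeft_induction
    (p := fun x => X x = Y x) (isClosed_eq X.continuous Y.continuous) (by simp)
    (fun x y hx hy => by rw [map_add, map_add, hx, hy])
    (fun z x hx => by rw [map_smul, map_smul, hx]) h x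

end Comultiplication

/-! ### Convolution operators as slices, and their dependence on the functional. -/

section Convolution

variable {A H : Type*} [NonUnitalCStarAlgebra A] [PartialOrder A] [StarOrderedRing A]
  [NormedAddCommGroup H] [InnerProductSpace ℂ H] [CompleteSpace H]
  (G : CancellativeComultiplication A H)

lemma slice_comulRight (ω : A →L[ℂ] ℂ) (a b : A) :
    slice G.π ω (G.comulRight a b) = G.leftConv ω a * b :=
  (sliceMul_mul G.π G.π_injective ω (G.isSliceable a) b).symm

/-- `L_ω(a)` is defined only through right multiplication by `b`, so the product `(1 ⊗ c)Δ(a)(1 ⊗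
b)` is bracketed in both ways. -/
lemma slice_comulLeft (ω : A →L[ℂ] ℂ) (c a : A) :
    slice G.π ω (G.comulLeft c a) = c * G.leftConv ω a := by
  refine eq_of_forall_mul_eq fun b => ?_
  rw [mul_assoc, ← slice_comulRight, ← slice_rightMul_oneTensor G.π G.π_injective,
    ← slice_leftMul_oneTensor G.π G.π_injective]
  exact congrArg _ (Subtype.ext (by simp [mul_assoc]))

lemma slice_leftMul_comul (ω : A →L[ℂ] ℂ) (a c y : A) :
    slice G.π ω (rightMul G.π (G.Δ y) (elemTensor G.π a c))
      = c * G.leftConv (leftMulFunctional ω a) y := by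
  refine eq_of_forall_mul_eq fun b => ?_
  rw [mul_assoc, ← slice_comulRight, ← slice_rightMul_oneTensor G.π G.π_injective,
    ← slice_leftMul_tensorElem G.π G.π_injective]
  exact congrArg _ (Subtype.ext (by simp [mul_assoc, tensorElem]))

lemma norm_leftConv_le (ω : A →L[ℂ] ℂ) : ‖G.leftConv ω‖ ≤ ‖ω‖ :=
  LinearMap.mkContinuous_norm_le _ (norm_nonneg _) _

/-- The adjoint of `Δ(a)(1 ⊗ b)` is `(1 ⊗ b*)Δ(a*)`. This symmetry later exchanges left and right
module identities by passing from `ω` to `ω^*`. -/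
lemma leftConv_starFunctional (ω : A →L[ℂ] ℂ) (a : A) :
    G.leftConv (starFunctional ω) a = star (G.leftConv ω (star a)) := by
  refine eq_of_forall_mul_eq fun b => ?_
  rw [← slice_comulRight, slice_starFunctional G.π G.π_injective]
  have : adjTensor G.π (G.comulRight a b) = G.comulLeft (star b) (star a) := by
    simp [comulLeft]
  rw [this, slice_comulLeft, star_mul, star_star]

lemma leftConv_add_functional (ω μ : A →L[ℂ] ℂ) :
    G.leftConv (ω + μ) = G.leftConv ω + G.leftConv μ :=
  ContinuousLinearMap.ext fun a => eq_of_forall_mul_eq fun b => by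
    rw [add_apply, add_mul]
    simp only [← slice_comulRight, slice_add_functional G.π G.π_injective]

lemma leftConv_smul_functional (c : ℂ) (ω : A →L[ℂ] ℂ) :
    G.leftConv (c • ω) = c • G.leftConv ω :=
  ContinuousLinearMap.ext fun a => eq_of_forall_mul_eq fun b => by
    rw [smul_apply, smul_mul_assoc]
    simp only [← slice_comulRight, slice_smul_functional G.π G.π_injective]

lemma leftConv_sub_functional (ω μ : A →L[ℂ] ℂ) :
    G.leftConv (ω - μ) = G.leftConv ω - G.leftConv μ := by
  have := G.leftConv_add_functional (ω - μ) μ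
  rw [sub_add_cancel] at this
  rw [this, add_sub_cancel_right]

end Convolution

end CancellativeComultiplication

/-! ### Coassociativity for convolution operators -/

section VectorTensor

variable {H K : Type*} [NormedAddCommGroup H] [InnerProductSpace ℂ H]
  [NormedAddCommGroup K] [InnerProductSpace ℂ K]

/-- The map `k ↦ h ⊗ k`. -/
def leftCreate (h : H) : K →L[ℂ] HilbertTensor H K :=
  LinearMap.mkContinuous
    { toFun := fun k => vecTensor h k
      map_add' := fun k k' => by simp [vecTensor, TensorProduct.tmul_add]
      map_smul' := fun c k => by simp [vecTensor, TensorProduct.tmul_smul] }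
    ‖h‖ (fun k => (norm_vecTensor h k).le)

lemma leftCreate_apply (h : H) (k : K) :
    (leftCreate h : K →L[ℂ] HilbertTensor H K) k = vecTensor h k := rfl

end VectorTensor

/-! ### Vector functionals, the Fubini rule for slices, and extension from vector functionals. -/

section VectorFunctionals

variable {A H : Type*} [NonUnitalCStarAlgebra A]
  [NormedAddCommGroup H] [InnerProductSpace ℂ H] [CompleteSpace H]
  (π : A →⋆ₙₐ[ℂ] (H →L[ℂ] H))

/-- Closedness makes the multiplier algebra a `C*`-algebra, so that its `*`-homomorphisms are
automatically contractive. -/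
lemma isClosed_multiplierTensor :
    IsClosed (multiplierTensor π : Set (HilbertTensor H H →L[ℂ] HilbertTensor H H)) := by
  have : (multiplierTensor π : Set (HilbertTensor H H →L[ℂ] HilbertTensor H H))
      = ⋂ y ∈ spatialTensor π, ((fun x => x * y) ⁻¹' (spatialTensor π : Set _)) ∩
        ((fun x => y * x) ⁻¹' (spatialTensor π : Set _)) := by
    ext x
    simp only [Set.mem_iInter]
    rfl
  rw [this]
  exact isClosed_biInter fun y _ =>
    ((isClosed_spatialTensor π).preimage (continuous_mul_const y)).inter
      ((isClosed_spatialTensor π).preimage (continuous_const_mul y))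

lemma norm_multiplierTensor_hom_le {K : Type*} [NormedAddCommGroup K] [InnerProductSpace ℂ K]
    [CompleteSpace K] (Φ : multiplierTensor π →⋆ₐ[ℂ] (K →L[ℂ] K)) (X : multiplierTensor π) :
    ‖Φ X‖ ≤ ‖X‖ := by
  have : IsClosed (multiplierTensor π : Set (HilbertTensor H H →L[ℂ] HilbertTensor H H)) :=
    isClosed_multiplierTensor π
  exact NonUnitalStarAlgHom.norm_apply_le Φ X

lemma continuous_apply_toMultiplier {K : Type*} [NormedAddCommGroup K] [InnerProductSpace ℂ K]
    [CompleteSpace K] (Φ : multiplierTensor π →⋆ₐ[ℂ] (K →L[ℂ] K)) :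
    Continuous fun T => Φ (toMultiplier π T) := by
  let L : spatialTensor π →ₗ[ℂ] (K →L[ℂ] K) :=
    { toFun := fun T => Φ (toMultiplier π T)
      map_add' := fun S T => (map_add Φ (toMultiplier π S) (toMultiplier π T))
      map_smul' := fun c T => (map_smul Φ c (toMultiplier π T)) }
  exact (L.mkContinuous 1 fun T => by
    rw [one_mul]; exact norm_multiplierTensor_hom_le π Φ (toMultiplier π T)).continuous

/-- The vector functional `a ↦ ⟨h, π(a) k⟩`. -/
def vectorFunctional (h k : H) : A →L[ℂ] ℂ :=
  LinearMap.mkContinuous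
    { toFun := fun a => inner ℂ h (π a k)
      map_add' := fun a b => by simp
      map_smul' := fun c a => by simp }
    (‖h‖ * ‖k‖) (fun a => by
      have h1 := NonUnitalStarAlgHom.norm_apply_le π a
      calc ‖inner ℂ h (π a k)‖ ≤ ‖h‖ * ‖π a k‖ := norm_inner_le_norm _ _
        _ ≤ ‖h‖ * (‖a‖ * ‖k‖) := by
          gcongr
          exact ((π a).le_opNorm k).trans (by gcongr)
        _ = _ := by ring)

lemma vectorFunctional_apply (h k : H) (a : A) :
    vectorFunctional π h k a = inner ℂ h (π a k) := rfl

lemma mulFunctional_vectorFunctional (h k : H) (e : A) :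
    mulFunctional (vectorFunctional π h k) e = vectorFunctional π h (π e k) :=
  ContinuousLinearMap.ext fun a => by
    simp [mulFunctional_apply, vectorFunctional_apply, map_mul]

lemma eq_of_vectorFunctional (hπ : Function.Injective π) {x y : A}
    (h : ∀ h k : H, vectorFunctional π h k x = vectorFunctional π h k y) : x = y :=
  hπ (ContinuousLinearMap.ext fun k => ext_inner_left ℂ fun z => h z k)

/-- The flip on `A ⊗ A`. -/
def flipSpatial : spatialTensor π →L[ℂ] spatialTensor π :=
  (((ContinuousLinearMap.mul ℂ (HilbertTensor H H →L[ℂ] HilbertTensor H H)).flip flipTensor ∘L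
    ContinuousLinearMap.mul ℂ (HilbertTensor H H →L[ℂ] HilbertTensor H H) flipTensor) ∘L
      (spatialTensor π).subtypeL).codRestrict _ fun y => by
    change flipTensor * y.1 * flipTensor ∈ spatialTensor π
    refine spatialTensor_induction π (p := fun y => flipTensor * y * flipTensor ∈ spatialTensor π)
      ((isClosed_spatialTensor π).preimage (by fun_prop)) (by simp)
      (fun x y hx hy => by simpa [add_mul, mul_add] using add_mem hx hy)
      (fun c x hx => by simpa using Submodule.smul_mem _ c hx) (fun a b => ?_) y.2
    rw [flipTensor_opTensor, mul_assoc, flipTensor_mul_self, mul_one]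
    exact opTensor_mem_spatialTensor π b a

lemma flipSpatial_elemTensor (a b : A) :
    flipSpatial π (elemTensor π a b) = elemTensor π b a := by
  refine Subtype.ext ?_
  change flipTensor * opTensor (π a) (π b) * flipTensor = opTensor (π b) (π a)
  rw [flipTensor_opTensor, mul_assoc, flipTensor_mul_self, mul_one]

/-- The slice map `id ⊗ ω`. -/
def rightSlice (ω : A →L[ℂ] ℂ) : spatialTensor π →L[ℂ] A := slice π ω ∘L flipSpatial π

lemma rightSlice_elemTensor (hπ : Function.Injective π) (ω : A →L[ℂ] ℂ) (a b : A) :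
    rightSlice π ω (elemTensor π a b) = ω b • a := by
  simp [rightSlice, flipSpatial_elemTensor, slice_elemTensor π hπ]

/-- Fubini for slices: the first functional is moved to the outside, displaying the expression as
`ω` evaluated at an element of `A`. -/
lemma apply_slice (hπ : Function.Injective π) (ω μ : A →L[ℂ] ℂ) (T : spatialTensor π) :
    μ (slice π ω T) = ω (rightSlice π μ T) := by
  have : μ ∘L slice π ω = ω ∘L rightSlice π μ := spatialTensor_clm_ext π fun a b => by
    simp [rightSlice_elemTensor π hπ, slice_elemTensor π hπ, mul_comm]
  exact congrArg (fun f => f T) this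

lemma inner_slice_vectorFunctional (hπ : Function.Injective π) (h k h' k' : H)
    (T : spatialTensor π) :
    inner ℂ h' (π (slice π (vectorFunctional π h k) T) k')
      = inner ℂ (vecTensor h h') (T.1 (vecTensor k k')) := by
  have : (vectorFunctional π h' k') ∘L slice π (vectorFunctional π h k)
      = (innerSL ℂ (vecTensor h h')) ∘L
        (ContinuousLinearMap.apply ℂ _ (vecTensor k k')) ∘L (spatialTensor π).subtypeL :=
    spatialTensor_clm_ext π fun a b => by
      simp [slice_elemTensor π hπ, opTensor_vecTensor, inner_vecTensor, vectorFunctional_apply]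
  exact congrArg (fun f => f T) this

/-- A bounded linear form on the dual of `A` which is, after each perturbation `ω ↦ ω(· e)`,
evaluation at an element of `A`, is determined by its values on vector functionals. -/
lemma dual_form_eq_zero [PartialOrder A] [StarOrderedRing A] (hπ : Function.Injective π)
    (F : (A →L[ℂ] ℂ) → ℂ) (hsub : ∀ ω μ, F (ω - μ) = F ω - F μ)
    (hb : ∃ C, ∀ ω, ‖F ω‖ ≤ C * ‖ω‖)
    (hx : ∀ e : A, ∃ x : A, ∀ ω, F (mulFunctional ω e) = ω x)
    (h0 : ∀ (h k : H) (e : A), F (vectorFunctional π h (π e k)) = 0) (ω : A →L[ℂ] ℂ) :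
    F ω = 0 := by
  have h1 : ∀ e, F (mulFunctional ω e) = 0 := by
    intro e
    obtain ⟨x, hx⟩ := hx e
    have : x = 0 := eq_of_vectorFunctional π hπ fun h k => by
      rw [← hx, mulFunctional_vectorFunctional, h0, map_zero]
    rw [hx, this, map_zero]
  obtain ⟨C, hC⟩ := hb
  have h2 : ∀ ε : ℝ, 0 < ε → ‖F ω‖ ≤ 0 + ε := by
    intro ε hε
    -- The denominator `|C| + 1` stays positive whatever the sign of `C`.
    obtain ⟨e, he⟩ := exists_mulFunctional_near π hπ ω
      (ε := ε / (|C| + 1)) (by positivity)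
    have h3 := hC (mulFunctional ω e - ω)
    rw [hsub, h1, zero_sub, norm_neg] at h3
    calc ‖F ω‖ ≤ C * ‖mulFunctional ω e - ω‖ := h3
      _ ≤ (|C| + 1) * (ε / (|C| + 1)) := by
        refine mul_le_mul ((le_abs_self C).trans (by linarith)) he (norm_nonneg _) (by positivity)
      _ = 0 + ε := by field_simp; ring
  exact norm_le_zero_iff.mp (le_of_forall_pos_le_add h2)

end VectorFunctionals

namespace CancellativeComultiplication

/-! ### Total sets coming from nondegeneracy. -/

section Density

variable {A H : Type*} [NonUnitalCStarAlgebra A]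
  [NormedAddCommGroup H] [InnerProductSpace ℂ H] [CompleteSpace H]
  (G : CancellativeComultiplication A H)

lemma continuous_comul : Continuous fun a => (G.Δ a).1 := by
  let L : A →ₗ[ℂ] (HilbertTensor H H →L[ℂ] HilbertTensor H H) :=
    { toFun := fun a => (G.Δ a).1
      map_add' := fun a b => by simp
      map_smul' := fun c a => by simp }
  exact (L.mkContinuous 1 fun a => by rw [one_mul]; exact G.norm_comul_le a).continuous

lemma clm_ext_rep {E : Type*} [NormedAddCommGroup E] [NormedSpace ℂ E] {X Y : H →L[ℂ] E}
    (h : ∀ a k, X (G.π a k) = Y (G.π a k)) : X = Y := by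
  refine ContinuousLinearMap.ext fun k => ?_
  have hk : k ∈ (Submodule.span ℂ (Set.range fun p : A × H => G.π p.1 p.2)).topologicalClosure := by
    rw [G.π_nondegenerate]; trivial
  have hle : Submodule.span ℂ (Set.range fun p : A × H => G.π p.1 p.2) ≤
      LinearMap.eqLocus X.toLinearMap Y.toLinearMap :=
    Submodule.span_le.mpr (by rintro _ ⟨p, rfl⟩; exact h p.1 p.2)
  exact closure_minimal (t := {k | X k = Y k}) (fun z hz => hle hz)
    (isClosed_eq X.continuous Y.continuous) hk

/-- Nondegeneracy of `Δ` makes the operators `Δ(a) S` total in `A ⊗ A`, and nondegeneracy of `π` in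
each leg makes `A ⊗ A` act nondegenerately. Hence the vectors `Δ(a) z` are total. -/
lemma clm_ext_comul {E : Type*} [NormedAddCommGroup E] [NormedSpace ℂ E]
    {X Y : HilbertTensor H H →L[ℂ] E}
    (h : ∀ a z, X ((G.Δ a).1 z) = Y ((G.Δ a).1 z)) : X = Y := by
  have h1 : ∀ S ∈ spatialTensor G.π, X ∘L S = Y ∘L S := by
    intro S hS
    rw [← G.Δ_nondegenerate] at hS
    refine closure_minimal (t := {S | X ∘L S = Y ∘L S}) (fun R hR => ?_)
      (isClosed_eq (by fun_prop) (by fun_prop)) hS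
    induction hR using Submodule.span_induction with
    | mem z hz =>
      obtain ⟨q, rfl⟩ := hz
      exact ContinuousLinearMap.ext fun v => h q.1 (q.2.1 v)
    | zero => simp
    | add u v _ _ hu hv =>
      change X ∘L (u + v) = Y ∘L (u + v)
      rw [ContinuousLinearMap.comp_add, ContinuousLinearMap.comp_add, hu, hv]
    | smul c u _ hu =>
      change X ∘L (c • u) = Y ∘L (c • u)
      rw [ContinuousLinearMap.comp_smul, ContinuousLinearMap.comp_smul, hu]
  refine clm_ext_vecTensor fun h k => ?_
  have h2 : ∀ k', X ∘L rightCreate k' = Y ∘L rightCreate k' := by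
    intro k'
    refine G.clm_ext_rep fun a h' => ?_
    have h3 : X ∘L leftCreate (G.π a h') = Y ∘L leftCreate (G.π a h') := by
      refine G.clm_ext_rep fun b k'' => ?_
      have := congrArg (fun f => f (vecTensor h' k''))
        (h1 _ (opTensor_mem_spatialTensor G.π a b))
      simpa [leftCreate_apply, opTensor_vecTensor] using this
    have := congrArg (fun f => f k') h3
    simpa [leftCreate_apply, rightCreate_apply] using this
  exact congrArg (fun f => f h) (h2 k)

end Density

/-! ### From matrix coefficients to `L_μ L_ω = L_{ω ⋆ μ}`. -/

section Coassociativity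

variable {A H : Type*} [NonUnitalCStarAlgebra A] [PartialOrder A] [StarOrderedRing A]
  [NormedAddCommGroup H] [InnerProductSpace ℂ H] [CompleteSpace H]
  (G : CancellativeComultiplication A H)

lemma slice_leftMul_comul_elemTensor (ω : A →L[ℂ] ℂ) (a e b : A) :
    slice G.π ω (leftMul G.π (G.Δ a) (elemTensor G.π e b))
      = G.leftConv (mulFunctional ω e) a * b := by
  rw [← slice_comulRight, ← slice_mul_left G.π G.π_injective]
  exact congrArg _ (Subtype.ext (by simp [mul_assoc, opTensor_mul]))

/-- `Δ(a)(e ⊗ 1)`, as an element of `A ⊗ A`. -/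
def comulRightFst (a e : A) : spatialTensor G.π :=
  ⟨(G.Δ a).1 * opTensor (G.π e) 1, (G.isSliceable a).left_mem e⟩

lemma slice_comulRightFst (ω : A →L[ℂ] ℂ) (a e : A) :
    slice G.π ω (G.comulRightFst a e) = G.leftConv (mulFunctional ω e) a := by
  refine eq_of_forall_mul_eq fun b => ?_
  rw [← slice_leftMul_comul_elemTensor, ← slice_rightMul_oneTensor G.π G.π_injective]
  exact congrArg _ (Subtype.ext (by simp [comulRightFst, mul_assoc, opTensor_mul]))

lemma inner_leftConv_vectorFunctional (h k h' k' : H) (a b : A) :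
    inner ℂ h' (G.π (G.leftConv (vectorFunctional G.π h k) a) (G.π b k'))
      = inner ℂ (vecTensor h h') ((G.Δ a).1 (vecTensor k (G.π b k'))) := by
  have := inner_slice_vectorFunctional G.π G.π_injective h k h' k' (G.comulRight a b)
  rw [slice_comulRight, map_mul] at this
  simpa [opTensor_vecTensor] using this

/-- Slicing the second leg leaves the factor `e` of the first leg outside. Fubini reduces this to
the known slices of the first leg, tested on vector functionals. -/
lemma rightSlice_leftMul_comul_elemTensor (ω : A →L[ℂ] ℂ) (a e b : A) :
    rightSlice G.π ω (leftMul G.π (G.Δ a) (elemTensor G.π e b))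
      = rightSlice G.π ω (G.comulRight a b) * e := by
  refine eq_of_vectorFunctional G.π G.π_injective fun h k => ?_
  rw [← apply_slice G.π G.π_injective, slice_leftMul_comul_elemTensor, ← slice_comulRight,
    apply_slice G.π G.π_injective, mulFunctional_apply]

section Extensions

/-- `Ψ` is prescribed only on elementary tensors. Contractivity extends the formula to `A ⊗ A`, and
`Δ(a)(e ⊗ b) ∈ A ⊗ A` reaches `Δ(a)`: the factor `Ψ(e ⊗ b)` contributes `π(e) ⊗ Δ(b)`, and the
vectors `Δ(b) z` are total. -/
lemma inner_idTensorComul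
    (Ψ : multiplierTensor G.π →⋆ₐ[ℂ]
      (HilbertTensor H (HilbertTensor H H) →L[ℂ] HilbertTensor H (HilbertTensor H H)))
    (hΨ : ∀ a b, Ψ (tensorElem G.π a b) = opTensor (G.π a) (G.Δ b).1)
    (h k : H) (z₀ z : HilbertTensor H H) (a e : A) :
    inner ℂ (vecTensor h z₀) (Ψ (G.Δ a) (vecTensor (G.π e k) z))
      = inner ℂ z₀ ((G.Δ (G.leftConv (vectorFunctional G.π h (G.π e k)) a)).1 z) := by
  have h1 : ∀ (T : spatialTensor G.π) (z : HilbertTensor H H),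
      inner ℂ (vecTensor h z₀) (Ψ (toMultiplier G.π T) (vecTensor k z))
        = inner ℂ z₀ ((G.Δ (slice G.π (vectorFunctional G.π h k) T)).1 z) := by
    intro T z
    refine spatialTensor_induction' G.π (p := fun T =>
      inner ℂ (vecTensor h z₀) (Ψ (toMultiplier G.π T) (vecTensor k z))
        = inner ℂ z₀ ((G.Δ (slice G.π (vectorFunctional G.π h k) T)).1 z))
      (isClosed_eq ?_ ?_) ?_ ?_ T
    · exact continuous_const.inner
        ((continuous_apply_toMultiplier G.π Ψ).clm_apply continuous_const)
    · exact continuous_const.inner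
        ((G.continuous_comul.comp (slice G.π _).continuous).clm_apply continuous_const)
    · intro S T hS hT
      have e1 : toMultiplier G.π (S + T) = toMultiplier G.π S + toMultiplier G.π T := rfl
      rw [e1, map_add, map_add, map_add]
      simp only [add_apply, inner_add_right, hS, hT, AddMemClass.coe_add]
    · intro a b
      rw [toMultiplier_elemTensor, hΨ, opTensor_vecTensor, inner_vecTensor,
        slice_elemTensor G.π G.π_injective, map_smul, vectorFunctional_apply]
      simp
  have h2 : innerSL ℂ (vecTensor h z₀) ∘L Ψ (G.Δ a) ∘L leftCreate (G.π e k)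
      = innerSL ℂ z₀ ∘L (G.Δ (G.leftConv (vectorFunctional G.π h (G.π e k)) a)).1 := by
    refine G.clm_ext_comul fun b z => ?_
    have h3 := h1 (leftMul G.π (G.Δ a) (elemTensor G.π e b)) z
    have e1 : toMultiplier G.π (leftMul G.π (G.Δ a) (elemTensor G.π e b))
        = G.Δ a * tensorElem G.π e b := rfl
    rw [e1, map_mul, hΨ, slice_leftMul_comul_elemTensor, mulFunctional_vectorFunctional,
      map_mul] at h3
    simpa [leftCreate_apply, opTensor_vecTensor] using h3
  exact congrArg (fun f => f z) h2

/-- Mirror image of `inner_idTensorComul`: here the last leg is sliced and `Δ` acts on what remains.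
-/
lemma inner_comulTensorId
    (Φ : multiplierTensor G.π →⋆ₐ[ℂ]
      (HilbertTensor (HilbertTensor H H) H →L[ℂ] HilbertTensor (HilbertTensor H H) H))
    (hΦ : ∀ a b, Φ (tensorElem G.π a b) = opTensor (G.Δ a).1 (G.π b))
    (h k : H) (z₀ z : HilbertTensor H H) (a b : A) :
    inner ℂ (vecTensor z₀ h) (Φ (G.Δ a) (vecTensor z (G.π b k)))
      = inner ℂ z₀ ((G.Δ (rightSlice G.π (vectorFunctional G.π h k) (G.comulRight a b))).1 z) := by
  have h1 : ∀ (T : spatialTensor G.π) (z : HilbertTensor H H),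
      inner ℂ (vecTensor z₀ h) (Φ (toMultiplier G.π T) (vecTensor z k))
        = inner ℂ z₀ ((G.Δ (rightSlice G.π (vectorFunctional G.π h k) T)).1 z) := by
    intro T z
    refine spatialTensor_induction' G.π (p := fun T =>
      inner ℂ (vecTensor z₀ h) (Φ (toMultiplier G.π T) (vecTensor z k))
        = inner ℂ z₀ ((G.Δ (rightSlice G.π (vectorFunctional G.π h k) T)).1 z))
      (isClosed_eq ?_ ?_) ?_ ?_ T
    · exact continuous_const.inner
        ((continuous_apply_toMultiplier G.π Φ).clm_apply continuous_const)
    · exact continuous_const.inner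
        ((G.continuous_comul.comp (rightSlice G.π _).continuous).clm_apply continuous_const)
    · intro S T hS hT
      have e1 : toMultiplier G.π (S + T) = toMultiplier G.π S + toMultiplier G.π T := rfl
      rw [e1, map_add, map_add, map_add]
      simp only [add_apply, inner_add_right, hS, hT, AddMemClass.coe_add]
    · intro a b
      rw [toMultiplier_elemTensor, hΦ, opTensor_vecTensor, inner_vecTensor,
        rightSlice_elemTensor G.π G.π_injective, map_smul, vectorFunctional_apply]
      simp [mul_comm]
  have h2 : innerSL ℂ (vecTensor z₀ h) ∘L Φ (G.Δ a) ∘L rightCreate (G.π b k)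
      = innerSL ℂ z₀ ∘L
        (G.Δ (rightSlice G.π (vectorFunctional G.π h k) (G.comulRight a b))).1 := by
    refine G.clm_ext_comul fun e z => ?_
    have h3 := h1 (leftMul G.π (G.Δ a) (elemTensor G.π e b)) z
    have e1 : toMultiplier G.π (leftMul G.π (G.Δ a) (elemTensor G.π e b))
        = G.Δ a * tensorElem G.π e b := rfl
    rw [e1, map_mul, hΦ, rightSlice_leftMul_comul_elemTensor, map_mul] at h3
    simpa [rightCreate_apply, opTensor_vecTensor] using h3
  exact congrArg (fun f => f z) h2

end Extensions

lemma apply_slice_conv (ω μ ψ : A →L[ℂ] ℂ) (a b : A) :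
    ψ (G.leftConv (G.conv ω μ) a * b)
      = μ (G.leftConv ω (rightSlice G.π ψ (G.comulRight a b))) := by
  rw [← slice_comulRight, apply_slice G.π G.π_injective]
  rfl

/-- The two sides are the same triple matrix coefficient, read through `id ⊗ Δ` and through `Δ ⊗
id`. Vectors of the form `π(e)k` keep every slice inside `A ⊗ A`. -/
lemma leftConv_leftConv_vectorFunctional (h₁ k₁ h₂ k₂ : H) (e f : A) (a : A) :
    G.leftConv (vectorFunctional G.π h₂ (G.π f k₂))
        (G.leftConv (vectorFunctional G.π h₁ (G.π e k₁)) a)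
      = G.leftConv (G.conv (vectorFunctional G.π h₁ (G.π e k₁))
          (vectorFunctional G.π h₂ (G.π f k₂))) a := by
  obtain ⟨Φ, Ψ, hΦ, hΨ, hc⟩ := G.coassociative
  refine G.π_injective (G.clm_ext_rep fun b k₃ => ext_inner_left ℂ fun h₃ => ?_)
  rw [inner_leftConv_vectorFunctional, ← G.inner_idTensorComul Ψ hΨ, ← hc,
    G.inner_comulTensorId Φ hΦ, ← inner_leftConv_vectorFunctional]
  have := apply_slice_conv G (vectorFunctional G.π h₁ (G.π e k₁))
    (vectorFunctional G.π h₂ (G.π f k₂)) (vectorFunctional G.π h₃ k₃) a b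
  rw [vectorFunctional_apply, map_mul] at this
  exact this.symm

lemma norm_conv_le (ω μ : A →L[ℂ] ℂ) : ‖G.conv ω μ‖ ≤ ‖ω‖ * ‖μ‖ := by
  refine (ContinuousLinearMap.opNorm_comp_le _ _).trans ?_
  rw [mul_comm]
  exact mul_le_mul_of_nonneg_right (G.norm_leftConv_le ω) (norm_nonneg _)

lemma norm_leftConv_apply_le (ω : A →L[ℂ] ℂ) (a : A) : ‖G.leftConv ω a‖ ≤ ‖ω‖ * ‖a‖ :=
  (G.leftConv ω).le_of_opNorm_le (G.norm_leftConv_le ω) a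

lemma conv_sub_left (ω ω' μ : A →L[ℂ] ℂ) :
    G.conv (ω - ω') μ = G.conv ω μ - G.conv ω' μ :=
  ContinuousLinearMap.ext fun a => by simp [conv, leftConv_sub_functional]

lemma conv_sub_right (ω μ μ' : A →L[ℂ] ℂ) :
    G.conv ω (μ - μ') = G.conv ω μ - G.conv ω μ' :=
  ContinuousLinearMap.ext fun a => by simp [conv]

/-- The failure of `L_μ L_ω = L_{ω ⋆ μ}`, tested on `ψ(· b)`. -/
def assocDefect (ω μ ψ : A →L[ℂ] ℂ) (a b : A) : ℂ :=
  ψ (G.leftConv μ (G.leftConv ω a) * b) - ψ (G.leftConv (G.conv ω μ) a * b)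

lemma norm_assocDefect_le (ω μ ψ : A →L[ℂ] ℂ) (a b : A) :
    ‖G.assocDefect ω μ ψ a b‖ ≤ 2 * ‖ψ‖ * ‖a‖ * ‖b‖ * ‖ω‖ * ‖μ‖ := by
  have h1 : ‖ψ (G.leftConv μ (G.leftConv ω a) * b)‖ ≤ ‖ψ‖ * ((‖μ‖ * (‖ω‖ * ‖a‖)) * ‖b‖) := by
    refine (ψ.le_opNorm _).trans (mul_le_mul_of_nonneg_left ?_ (norm_nonneg _))
    refine (norm_mul_le _ _).trans (mul_le_mul_of_nonneg_right ?_ (norm_nonneg _))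
    exact (G.norm_leftConv_apply_le _ _).trans
      (mul_le_mul_of_nonneg_left (G.norm_leftConv_apply_le _ _) (norm_nonneg _))
  have h2 : ‖ψ (G.leftConv (G.conv ω μ) a * b)‖ ≤ ‖ψ‖ * (((‖ω‖ * ‖μ‖) * ‖a‖) * ‖b‖) := by
    refine (ψ.le_opNorm _).trans (mul_le_mul_of_nonneg_left ?_ (norm_nonneg _))
    refine (norm_mul_le _ _).trans (mul_le_mul_of_nonneg_right ?_ (norm_nonneg _))
    exact (G.norm_leftConv_apply_le _ _).trans
      (mul_le_mul_of_nonneg_right (G.norm_conv_le _ _) (norm_nonneg _))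
  refine (norm_sub_le _ _).trans ((add_le_add h1 h2).trans (le_of_eq (by ring)))

lemma assocDefect_sub_left (ω ω' μ ψ : A →L[ℂ] ℂ) (a b : A) :
    G.assocDefect (ω - ω') μ ψ a b = G.assocDefect ω μ ψ a b - G.assocDefect ω' μ ψ a b := by
  simp only [assocDefect, conv_sub_left, leftConv_sub_functional, sub_apply, map_sub, sub_mul]
  ring

lemma assocDefect_sub_right (ω μ μ' ψ : A →L[ℂ] ℂ) (a b : A) :
    G.assocDefect ω (μ - μ') ψ a b = G.assocDefect ω μ ψ a b - G.assocDefect ω μ' ψ a b := by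
  simp only [assocDefect, conv_sub_right, leftConv_sub_functional, sub_apply, map_sub, sub_mul]
  ring

/-- Supplies the evaluation hypothesis of `dual_form_eq_zero`: with the factor `f` absorbed,
`Δ(L_ω(a))(f ⊗ b)` lies in `A ⊗ A`, and Fubini pulls `μ` out. -/
lemma exists_assocDefect_mulFunctional_right (ω ψ : A →L[ℂ] ℂ) (a b f : A) :
    ∃ x : A, ∀ μ, G.assocDefect ω (mulFunctional μ f) ψ a b = μ x := by
  refine ⟨rightSlice G.π ψ (leftMul G.π (G.Δ (G.leftConv ω a)) (elemTensor G.π f b))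
    - G.leftConv ω (rightSlice G.π ψ (G.comulRight a b)) * f, fun μ => ?_⟩
  rw [assocDefect, apply_slice_conv, ← slice_leftMul_comul_elemTensor,
    apply_slice G.π G.π_injective, mulFunctional_apply, map_sub]

lemma exists_assocDefect_mulFunctional_left (μ ψ : A →L[ℂ] ℂ) (a b e : A) :
    ∃ x : A, ∀ ω, G.assocDefect (mulFunctional ω e) μ ψ a b = ω x := by
  refine ⟨rightSlice G.π (mulFunctional ψ b ∘L G.leftConv μ) (G.comulRightFst a e)
    - rightSlice G.π μ (G.comulRightFst (rightSlice G.π ψ (G.comulRight a b)) e), fun ω => ?_⟩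
  rw [assocDefect, apply_slice_conv, ← slice_comulRightFst, ← slice_comulRightFst, map_sub,
    ← apply_slice G.π G.π_injective, ← apply_slice G.π G.π_injective]
  rfl

/-- Coassociativity: `L_μ L_ω = L_{ω ⋆ μ}`. -/
theorem leftConv_leftConv (ω μ : A →L[ℂ] ℂ) (a : A) :
    G.leftConv μ (G.leftConv ω a) = G.leftConv (G.conv ω μ) a := by
  refine eq_of_forall_mul_eq fun b => eq_of_vectorFunctional G.π G.π_injective fun h k => ?_
  set ψ := vectorFunctional G.π h k
  rw [← sub_eq_zero]
  change G.assocDefect ω μ ψ a b = 0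
  -- One variable at a time: `μ` becomes arbitrary while `ω` is still a vector functional, and `ω`
  -- is freed afterwards.
  have h1 : ∀ (h₁ k₁ : H) (e : A) (μ : A →L[ℂ] ℂ),
      G.assocDefect (vectorFunctional G.π h₁ (G.π e k₁)) μ ψ a b = 0 := fun h₁ k₁ e μ =>
    dual_form_eq_zero G.π G.π_injective
      (fun μ => G.assocDefect (vectorFunctional G.π h₁ (G.π e k₁)) μ ψ a b)
      (fun μ μ' => G.assocDefect_sub_right _ _ _ _ _ _)
      ⟨_, fun μ => G.norm_assocDefect_le _ _ _ _ _⟩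
      (fun f => G.exists_assocDefect_mulFunctional_right _ _ _ _ _)
      (fun h₂ k₂ f => by
        rw [assocDefect, leftConv_leftConv_vectorFunctional, sub_self]) μ
  exact dual_form_eq_zero G.π G.π_injective (fun ω => G.assocDefect ω μ ψ a b)
    (fun ω ω' => G.assocDefect_sub_left _ _ _ _ _ _)
    ⟨2 * ‖ψ‖ * ‖a‖ * ‖b‖ * ‖μ‖, fun ω =>
      (G.norm_assocDefect_le _ _ _ _ _).trans (le_of_eq (by ring))⟩
    (fun e => G.exists_assocDefect_mulFunctional_left _ _ _ _ _)
    (fun h₁ k₁ e => h1 h₁ k₁ e μ) ω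

end Coassociativity

end CancellativeComultiplication

/-! ### Positive sesquilinear forms -/

section Sesquilinear

open ComplexConjugate

variable {E : Type*} [AddCommGroup E] [Module ℂ E]

/-- Polarisation: the diagonal values at `x + y` and `x + i y` are real, which compares the
imaginary and the real parts respectively. -/
lemma sesquilinear_conj_symm (s : E →ₗ⋆[ℂ] E →ₗ[ℂ] ℂ) (hs : ∀ x, 0 ≤ s x x) (x y : E) :
    conj (s y x) = s x y := by
  have him : ∀ z, (s z z).im = 0 := fun z => (Complex.nonneg_iff.mp (hs z)).2.symm
  have h1 := him (x + y)
  have h2 := him (x + Complex.I • y)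
  simp only [map_add, LinearMap.add_apply, LinearMap.map_smulₛₗ, LinearMap.smul_apply,
    Complex.add_im, him, Complex.conj_I, smul_eq_mul, RingHom.id_apply, Complex.mul_im,
    Complex.neg_re, Complex.neg_im, Complex.I_re, Complex.I_im, Complex.mul_re, Complex.add_re] at h1 h2
  refine Complex.ext ?_ ?_
  · rw [Complex.conj_re]; linarith
  · rw [Complex.conj_im]; linarith

lemma sesquilinear_cauchy_schwarz (s : E →ₗ⋆[ℂ] E →ₗ[ℂ] ℂ) (hs : ∀ x, 0 ≤ s x x) (x y : E) :
    ‖s x y‖ ^ 2 ≤ (s x x).re * (s y y).re := by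
  let c : PreInnerProductSpace.Core ℂ E :=
    { inner := fun x y => s x y
      conj_inner_symm := sesquilinear_conj_symm s hs
      re_inner_nonneg := fun x => (Complex.nonneg_iff.mp (hs x)).1
      add_left := fun x y z => by simp
      smul_left := fun x y r => by simp }
  have h := @InnerProductSpace.Core.inner_mul_inner_self_le ℂ E _ _ _ c x y
  change ‖s x y‖ * ‖s y x‖ ≤ (s x x).re * (s y y).re at h
  rwa [← sesquilinear_conj_symm s hs y x, RCLike.norm_conj, ← sq] at h

lemma posSemidef_gram (s : E →ₗ⋆[ℂ] E →ₗ[ℂ] ℂ) (hs : ∀ x, 0 ≤ s x x) {n : ℕ} (v : Fin n → E) :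
    (Matrix.of fun i j => s (v i) (v j)).PosSemidef := by
  refine Matrix.PosSemidef.of_dotProduct_mulVec_nonneg ?_ fun x => ?_
  · ext i j
    exact sesquilinear_conj_symm s hs _ _
  · have : star x ⬝ᵥ (Matrix.of fun i j => s (v i) (v j)).mulVec x
        = s (∑ i, x i • v i) (∑ i, x i • v i) := by
      simp only [dotProduct, Matrix.mulVec, map_sum, LinearMap.sum_apply, LinearMap.map_smulₛₗ,
        LinearMap.smul_apply, smul_eq_mul, Finset.mul_sum, Matrix.of_apply, Pi.star_apply,
        RingHom.id_apply]
      rw [Finset.sum_comm]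
      refine Finset.sum_congr rfl fun i _ => Finset.sum_congr rfl fun j _ => ?_
      simp only [RCLike.star_def]
      ring
    rw [this]
    exact hs _

/-- The Schur product of two positive forms is positive. -/
lemma sum_mul_gram_nonneg {F : Type*} [AddCommGroup F] [Module ℂ F]
    (s : E →ₗ⋆[ℂ] E →ₗ[ℂ] ℂ) (hs : ∀ x, 0 ≤ s x x)
    (t : F →ₗ⋆[ℂ] F →ₗ[ℂ] ℂ) (ht : ∀ x, 0 ≤ t x x) {n : ℕ} (v : Fin n → E) (w : Fin n → F) :
    0 ≤ ∑ i, ∑ j, s (v i) (v j) * t (w i) (w j) := by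
  have h := ((posSemidef_gram s hs v).hadamard (posSemidef_gram t ht w)).dotProduct_mulVec_nonneg
    (fun _ => 1)
  simpa [dotProduct, Matrix.mulVec, Matrix.hadamard_apply] using h

end Sesquilinear

/-! ### Positive functionals dominating a contractive functional -/

section Majorant

open Filter Topology

variable {A : Type*} [NonUnitalCStarAlgebra A]

/-- The sesquilinear form `φ(a* b)`. -/
def gnsForm (φ : A →L[ℂ] ℂ) : A →ₗ⋆[ℂ] A →ₗ[ℂ] ℂ :=
  LinearMap.mk₂'ₛₗ (starRingEnd ℂ) (RingHom.id ℂ) (fun a b => φ (star a * b))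
    (fun a b c => by simp [add_mul]) (fun z a b => by simp [smul_mul_assoc])
    (fun a b c => by simp [mul_add]) (fun z a b => by simp [mul_smul_comm])

lemma gnsForm_apply (φ : A →L[ℂ] ℂ) (a b : A) : gnsForm φ a b = φ (star a * b) := rfl

/-- The sesquilinear form `φ(a* b) - conj ω(a) ω(b)`. -/
def defectForm (φ ω : A →L[ℂ] ℂ) : A →ₗ⋆[ℂ] A →ₗ[ℂ] ℂ :=
  LinearMap.mk₂'ₛₗ (starRingEnd ℂ) (RingHom.id ℂ)
    (fun a b => φ (star a * b) - star (ω a) * ω b)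
    (fun a b c => by simp [add_mul]; ring) (fun z a b => by simp [smul_mul_assoc]; ring)
    (fun a b c => by simp [mul_add]; ring) (fun z a b => by simp [mul_smul_comm]; ring)

lemma defectForm_apply (φ ω : A →L[ℂ] ℂ) (a b : A) :
    defectForm φ ω a b = φ (star a * b) - star (ω a) * ω b := rfl

lemma re_apply_le_norm {φ : A →L[ℂ] ℂ} (h : ‖φ‖ ≤ 1) (a : A) : (φ a).re ≤ ‖a‖ :=
  (Complex.re_le_norm _).trans (φ.le_of_opNorm_le h a |>.trans_eq (one_mul _))

/-- A sequence in the unit ball along which `ω` tends to `1`. -/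
structure IsNorming (ω : A →L[ℂ] ℂ) (e : ℕ → A) : Prop where
  norm_le : ∀ n, ‖e n‖ ≤ 1
  tendsto : Tendsto (fun n => ω (e n)) atTop (𝓝 1)

lemma exists_isNorming {ω : A →L[ℂ] ℂ} (h : ‖ω‖ = 1) : ∃ e, IsNorming ω e := by
  have hn : ∀ n : ℕ, ∃ a : A, ‖a‖ ≤ 1 ∧ ‖ω a - 1‖ ≤ 1 / ((n : ℝ) + 1) := by
    intro n
    have hp : 0 < 1 / ((n : ℝ) + 1) := Nat.one_div_pos_of_nat
    obtain ⟨a, ha, haω⟩ := ω.exists_lt_apply_of_lt_opNorm (r := ‖ω‖ - 1 / ((n : ℝ) + 1))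
      (by linarith)
    -- A phase rotation makes the value real, so that closeness to `‖ω‖ = 1` in modulus becomes
    -- closeness to `1`.
    obtain ⟨c, hc, hcz⟩ : ∃ c : ℂ, ‖c‖ ≤ 1 ∧ c * ω a = ‖ω a‖ := by
      rcases eq_or_ne (ω a) 0 with hz | hz
      · exact ⟨0, by simp, by simp [hz]⟩
      · refine ⟨(‖ω a‖ : ℂ) / ω a, ?_, ?_⟩
        · rw [norm_div, Complex.norm_real, norm_norm, div_self (norm_ne_zero_iff.mpr hz)]
        · field_simp
    refine ⟨c • a, ?_, ?_⟩
    · rw [norm_smul]; exact mul_le_one₀ hc (norm_nonneg _) ha.le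
    · rw [map_smul, smul_eq_mul, hcz, ← Complex.ofReal_one, ← Complex.ofReal_sub,
        Complex.norm_real, Real.norm_eq_abs, abs_le]
      have : ‖ω a‖ ≤ 1 := by
        refine (ω.le_opNorm a).trans ?_
        rw [h, one_mul]; exact ha.le
      constructor <;> linarith
  choose e he1 he2 using hn
  refine ⟨e, he1, ?_⟩
  rw [tendsto_iff_norm_sub_tendsto_zero]
  exact squeeze_zero (fun _ => norm_nonneg _) he2 tendsto_one_div_add_atTop_nhds_zero_nat

lemma IsNorming.star {ω : A →L[ℂ] ℂ} {e : ℕ → A} (he : IsNorming ω e) :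
    IsNorming (starFunctional ω) (fun n => star (e n)) where
  norm_le n := by rw [norm_star]; exact he.norm_le n
  tendsto := by
    have := (continuous_star.tendsto _).comp he.tendsto
    rw [star_one] at this
    refine this.congr fun n => ?_
    simp [starFunctional_apply]

lemma IsNorming.tendsto_one_sub_norm_sq {ω : A →L[ℂ] ℂ} {e : ℕ → A} (he : IsNorming ω e) :
    Tendsto (fun n => 1 - ‖ω (e n)‖ ^ 2) atTop (𝓝 0) := by
  have := (he.tendsto.norm.pow 2).const_sub (1 : ℝ)
  simpa using this

lemma tendsto_zero_of_norm_sq_le {f : ℕ → ℂ} {g : ℕ → ℝ} (hfg : ∀ n, ‖f n‖ ^ 2 ≤ g n)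
    (hg : Tendsto g atTop (𝓝 0)) : Tendsto f atTop (𝓝 0) := by
  rw [tendsto_zero_iff_norm_tendsto_zero]
  have h := (squeeze_zero (fun n => sq_nonneg ‖f n‖) hfg hg).sqrt
  simpa [Real.sqrt_sq] using h

variable [PartialOrder A] [StarOrderedRing A]

/-- `φ` is positive and contractive with `|ω(a)|² ≤ φ(a* a)`. -/
structure IsMajorant (φ ω : A →L[ℂ] ℂ) : Prop where
  pos : IsPositiveFunctional φ
  norm_le : ‖φ‖ ≤ 1
  bound : ∀ a, ‖ω a‖ ^ 2 ≤ (φ (star a * a)).re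

lemma gnsForm_nonneg {φ : A →L[ℂ] ℂ} (hφ : IsPositiveFunctional φ) (a : A) :
    0 ≤ gnsForm φ a a := hφ _ (star_mul_self_nonneg a)

lemma IsMajorant.defectForm_nonneg {φ ω : A →L[ℂ] ℂ} (h : IsMajorant φ ω) (a : A) :
    0 ≤ defectForm φ ω a a := by
  rw [defectForm_apply, RCLike.star_def, Complex.conj_mul', sub_nonneg, Complex.le_def]
  have := Complex.nonneg_iff.mp (h.pos _ (star_mul_self_nonneg a))
  refine ⟨?_, ?_⟩
  · exact_mod_cast h.bound a
  · rw [← this.2]; norm_cast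

lemma IsPositiveFunctional.map_star {φ : A →L[ℂ] ℂ} (hφ : IsPositiveFunctional φ) (a : A) :
    φ (star a) = star (φ a) := by
  have hl := CStarAlgebra.increasingApproximateUnit A
  have h1 : Tendsto (fun u => φ (star a * u)) (CStarAlgebra.approximateUnit A) (𝓝 (φ (star a))) :=
    (φ.continuous.tendsto _).comp (hl.tendsto_mul_left (star a))
  have h2 : Tendsto (fun u => star (φ (u * a))) (CStarAlgebra.approximateUnit A)
      (𝓝 (star (φ a))) :=
    (continuous_star.tendsto _).comp ((φ.continuous.tendsto _).comp (hl.tendsto_mul_right a))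
  refine tendsto_nhds_unique h1 (h2.congr' ?_)
  filter_upwards [hl.eventually_star_eq] with u hu
  have := sesquilinear_conj_symm (gnsForm φ) (gnsForm_nonneg hφ) a u
  rw [gnsForm_apply, gnsForm_apply, hu] at this
  exact this

lemma IsPositiveFunctional.starFunctional_eq {φ : A →L[ℂ] ℂ} (hφ : IsPositiveFunctional φ) :
    starFunctional φ = φ :=
  ContinuousLinearMap.ext fun a => by rw [starFunctional_apply, hφ.map_star, star_star]

lemma IsPositiveFunctional.isMajorant_self {φ : A →L[ℂ] ℂ} (hφ : IsPositiveFunctional φ)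
    (h : ‖φ‖ ≤ 1) : IsMajorant φ φ where
  pos := hφ
  norm_le := h
  bound a := by
    have hl := CStarAlgebra.increasingApproximateUnit A
    have h1 : Tendsto (fun u => ‖φ (u * a)‖ ^ 2) (CStarAlgebra.approximateUnit A)
        (𝓝 (‖φ a‖ ^ 2)) :=
      (((φ.continuous.tendsto _).comp (hl.tendsto_mul_right a)).norm).pow 2
    refine le_of_tendsto h1 ?_
    filter_upwards [hl.eventually_star_eq, hl.eventually_norm] with u hu hu1
    have h2 := sesquilinear_cauchy_schwarz (gnsForm φ) (gnsForm_nonneg hφ) u a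
    simp only [gnsForm_apply, hu] at h2
    have h3 : 0 ≤ (φ (star a * a)).re :=
      (Complex.nonneg_iff.mp (hφ _ (star_mul_self_nonneg a))).1
    refine h2.trans (mul_le_of_le_one_left h3 ((re_apply_le_norm h _).trans ?_))
    exact (norm_mul_le u u).trans (mul_le_one₀ hu1 (norm_nonneg _) hu1)

/-- If `φ(h)` is close to one, then `h` acts almost as a unit under `φ`. Cauchy–Schwarz is applied
to `u - h` and `b`, with `u` an approximate unit standing in for the missing unit, and `φ((u - h)²)
≤ 2 - φ(uh) - φ(hu)` in real parts. -/
lemma norm_apply_sub_apply_mul_sq_le {φ : A →L[ℂ] ℂ} (hφ : IsPositiveFunctional φ) (h1 : ‖φ‖ ≤ 1)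
    {h : A} (hs : star h = h) (hn : ‖h‖ ≤ 1) (b : A) :
    ‖φ b - φ (h * b)‖ ^ 2 ≤ (2 - 2 * (φ h).re) * (φ (star b * b)).re := by
  have hl := CStarAlgebra.increasingApproximateUnit A
  have hb : 0 ≤ (φ (star b * b)).re :=
    (Complex.nonneg_iff.mp (hφ _ (star_mul_self_nonneg b))).1
  have t1 : Tendsto (fun u => ‖φ (u * b) - φ (h * b)‖ ^ 2) (CStarAlgebra.approximateUnit A)
      (𝓝 (‖φ b - φ (h * b)‖ ^ 2)) :=
    ((((φ.continuous.tendsto _).comp (hl.tendsto_mul_right b)).sub tendsto_const_nhds).norm).pow 2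
  have t2 : Tendsto (fun u => (2 - (φ (u * h)).re - (φ (h * u)).re) * (φ (star b * b)).re)
      (CStarAlgebra.approximateUnit A)
      (𝓝 ((2 - (φ h).re - (φ h).re) * (φ (star b * b)).re)) := by
    have c : Continuous fun a => (φ a).re := Complex.continuous_re.comp φ.continuous
    exact ((tendsto_const_nhds.sub ((c.tendsto _).comp (hl.tendsto_mul_right h))).sub
      ((c.tendsto _).comp (hl.tendsto_mul_left h))).mul_const _
  have e : (2 - 2 * (φ h).re) = 2 - (φ h).re - (φ h).re := by ring
  rw [e]
  refine le_of_tendsto_of_tendsto t1 t2 ?_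
  filter_upwards [hl.eventually_star_eq, hl.eventually_norm] with u hu hu1
  have h2 := sesquilinear_cauchy_schwarz (gnsForm φ) (gnsForm_nonneg hφ) (u - h) b
  simp only [gnsForm_apply, star_sub, hu, hs] at h2
  rw [sub_mul, map_sub] at h2
  refine h2.trans (mul_le_mul_of_nonneg_right ?_ hb)
  rw [mul_sub, sub_mul, sub_mul, map_sub, map_sub, map_sub]
  simp only [Complex.sub_re]
  have h3 : (φ (u * u)).re ≤ 1 := (re_apply_le_norm h1 _).trans
    ((norm_mul_le u u).trans (mul_le_one₀ hu1 (norm_nonneg _) hu1))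
  have h4 : (φ (h * h)).re ≤ 1 := (re_apply_le_norm h1 _).trans
    ((norm_mul_le h h).trans (mul_le_one₀ hn (norm_nonneg _) hn))
  linarith

/-- Cauchy–Schwarz for the defect form, whose diagonal value at `eₙ` is at most `1 - |ω(eₙ)|²` and
so vanishes in the limit. -/
lemma IsMajorant.norm_defect_le {φ ω : A →L[ℂ] ℂ} (h : IsMajorant φ ω) {e : ℕ → A}
    (he : IsNorming ω e) (n : ℕ) (b : A) :
    ‖φ (star (e n) * b) - star (ω (e n)) * ω b‖ ^ 2 ≤ (1 - ‖ω (e n)‖ ^ 2) * ‖b‖ ^ 2 := by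
  have h1 := sesquilinear_cauchy_schwarz (defectForm φ ω) h.defectForm_nonneg (e n) b
  have hd : ∀ a, (defectForm φ ω a a).re = (φ (star a * a)).re - ‖ω a‖ ^ 2 := fun a => by
    rw [defectForm_apply, RCLike.star_def, Complex.conj_mul', Complex.sub_re]
    norm_cast
  have hφ : ∀ a, (φ (star a * a)).re ≤ ‖a‖ ^ 2 := fun a => by
    refine (re_apply_le_norm h.norm_le _).trans ?_
    rw [CStarRing.norm_star_mul_self, sq]
  rw [hd, hd, defectForm_apply] at h1
  refine h1.trans (mul_le_mul ?_ ?_ (sub_nonneg.mpr (h.bound b)) ?_)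
  · have := (hφ (e n)).trans (pow_le_one₀ (norm_nonneg _) (he.norm_le n))
    linarith
  · have := hφ b
    nlinarith [sq_nonneg ‖ω b‖]
  · have h2 := (h.bound (e n)).trans ((hφ (e n)).trans (pow_le_one₀ (norm_nonneg _) (he.norm_le n)))
    linarith

/-- Recovers `ω` from `φ`, a substitute for the polar decomposition that stays inside `A`. -/
lemma IsMajorant.tendsto_left {φ ω : A →L[ℂ] ℂ} (h : IsMajorant φ ω) {e : ℕ → A}
    (he : IsNorming ω e) (b : A) :
    Tendsto (fun n => φ (star (e n) * b)) atTop (𝓝 (ω b)) := by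
  have h1 : Tendsto (fun n => φ (star (e n) * b) - star (ω (e n)) * ω b) atTop (𝓝 0) := by
    have := he.tendsto_one_sub_norm_sq.mul_const (‖b‖ ^ 2)
    rw [zero_mul] at this
    exact tendsto_zero_of_norm_sq_le (fun n => h.norm_defect_le he n b) this
  have h2 : Tendsto (fun n => star (ω (e n)) * ω b) atTop (𝓝 (star 1 * ω b)) :=
    ((continuous_star.tendsto _).comp he.tendsto).mul_const _
  have := h1.add h2
  simpa using this

/-- Recovers `φ` from `ω`: `ω(eₙ b)` is close to `φ(eₙ* eₙ b)` by the defect bound, and this is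
close to `φ(b)`. -/
lemma IsMajorant.tendsto_right {φ ω : A →L[ℂ] ℂ} (h : IsMajorant φ ω) {e : ℕ → A}
    (he : IsNorming ω e) (b : A) :
    Tendsto (fun n => ω (e n * b)) atTop (𝓝 (φ b)) := by
  have hnb : ∀ n, ‖e n * b‖ ≤ ‖b‖ := fun n =>
    (norm_mul_le _ _).trans (mul_le_of_le_one_left (norm_nonneg _) (he.norm_le n))
  have h1 : Tendsto (fun n => φ (star (e n) * (e n * b)) - star (ω (e n)) * ω (e n * b))
      atTop (𝓝 0) := by
    have := he.tendsto_one_sub_norm_sq.mul_const (‖b‖ ^ 2)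
    rw [zero_mul] at this
    refine tendsto_zero_of_norm_sq_le (fun n => (h.norm_defect_le he n (e n * b)).trans
      (mul_le_mul_of_nonneg_left (pow_le_pow_left₀ (norm_nonneg _) (hnb n) 2) ?_)) this
    · have h4 := (h.bound (e n)).trans (re_apply_le_norm h.norm_le _)
      rw [CStarRing.norm_star_mul_self] at h4
      nlinarith [he.norm_le n, norm_nonneg (e n)]
  -- `eₙ* eₙ` acts as a unit in the limit because `φ(eₙ* eₙ) ≥ |ω(eₙ)|² → 1`.
  have h2 : Tendsto (fun n => φ b - φ (star (e n) * (e n * b))) atTop (𝓝 0) := by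
    have hb : 0 ≤ (φ (star b * b)).re :=
      (Complex.nonneg_iff.mp (h.pos _ (star_mul_self_nonneg b))).1
    have := (he.tendsto_one_sub_norm_sq.const_mul 2).mul_const ((φ (star b * b)).re)
    rw [mul_zero, zero_mul] at this
    refine tendsto_zero_of_norm_sq_le (fun n => ?_) this
    · rw [← mul_assoc]
      refine (norm_apply_sub_apply_mul_sq_le h.pos h.norm_le (h := star (e n) * e n) (by simp)
        ?_ b).trans (mul_le_mul_of_nonneg_right ?_ hb)
      · rw [CStarRing.norm_star_mul_self]
        exact mul_le_one₀ (he.norm_le n) (norm_nonneg _) (he.norm_le n)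
      · have := h.bound (e n)
        linarith
  have h3 : Tendsto (fun n => (star (ω (e n)) - 1) * ω (e n * b)) atTop (𝓝 0) := by
    have h4 : Tendsto (fun n => star (ω (e n)) - 1) atTop (𝓝 0) := by
      have := ((continuous_star.tendsto _).comp he.tendsto).sub_const 1
      simpa using this
    refine h4.zero_mul_isBoundedUnder_le (isBoundedUnder_of ⟨‖ω‖ * ‖b‖, fun n => ?_⟩)
    exact (ω.le_opNorm _).trans (mul_le_mul_of_nonneg_left (hnb n) (norm_nonneg _))
  have h4 := ((tendsto_const_nhds (x := φ b)).sub h1).sub (h2.add h3)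
  simp only [sub_zero, add_zero] at h4
  refine h4.congr fun n => ?_
  ring

lemma IsMajorant.unique {φ φ' ω : A →L[ℂ] ℂ} (h : IsMajorant φ ω) (h' : IsMajorant φ' ω)
    (hω : ‖ω‖ = 1) : φ = φ' := by
  obtain ⟨e, he⟩ := exists_isNorming hω
  exact ContinuousLinearMap.ext fun b =>
    tendsto_nhds_unique (h.tendsto_right he b) (h'.tendsto_right he b)

lemma IsMajorant.norm_eq {φ ω : A →L[ℂ] ℂ} (h : IsMajorant φ ω) (hω : ‖ω‖ = 1) : ‖φ‖ = 1 := by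
  refine le_antisymm h.norm_le ?_
  have h1 : ∀ a, ‖ω a‖ ≤ √‖φ‖ * ‖a‖ := fun a => by
    refine abs_le_of_sq_le_sq' (a := ‖ω a‖) ?_ (by positivity) |>.2
    refine (h.bound a).trans ((Complex.re_le_norm _).trans ((φ.le_opNorm _).trans (le_of_eq ?_)))
    rw [CStarRing.norm_star_mul_self, mul_pow, Real.sq_sqrt (norm_nonneg _), sq]
  have h2 := ω.opNorm_le_bound (Real.sqrt_nonneg _) h1
  rw [hω] at h2
  exact Real.one_le_sqrt.mp h2

end Majorant

/-! ### Existence of a majorant by Hahn–Banach. -/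

section MajorantExistence

open Filter Topology

variable {A H : Type*} [NonUnitalCStarAlgebra A]
  [NormedAddCommGroup H] [InnerProductSpace ℂ H] [CompleteSpace H]

/-- Cauchy–Schwarz for finite families in a `C*`-algebra. -/
lemma norm_sum_smul_sq_le (π : A →⋆ₙₐ[ℂ] (H →L[ℂ] H)) (hπ : Function.Injective π) {n : ℕ}
    (c : Fin n → ℂ) (a : Fin n → A) :
    ‖∑ i, c i • a i‖ ^ 2 ≤ (∑ i, ‖c i‖ ^ 2) * ‖∑ i, star (a i) * a i‖ := by
  have hiso : ∀ a, ‖π a‖ = ‖a‖ := NonUnitalStarAlgHom.norm_map π hπ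
  have hC : 0 ≤ ∑ i, ‖c i‖ ^ 2 := Finset.sum_nonneg fun _ _ => sq_nonneg _
  rw [← hiso]
  refine (Real.le_sqrt (norm_nonneg _) (by positivity)).mp ?_
  refine ContinuousLinearMap.opNorm_le_bound _ (Real.sqrt_nonneg _) fun h => ?_
  refine abs_le_of_sq_le_sq' (a := ‖π (∑ i, c i • a i) h‖) ?_ (by positivity) |>.2
  have h1 : ‖π (∑ i, c i • a i) h‖ ≤ ∑ i, ‖c i‖ * ‖π (a i) h‖ := by
    rw [map_sum, sum_apply]
    refine (norm_sum_le _ _).trans (Finset.sum_le_sum fun i _ => ?_)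
    rw [map_smul, smul_apply, norm_smul]
  have h2 : ∑ i, ‖π (a i) h‖ ^ 2 ≤ ‖∑ i, star (a i) * a i‖ * ‖h‖ ^ 2 := by
    have e : ∑ i, ‖π (a i) h‖ ^ 2 = (inner ℂ h (π (∑ i, star (a i) * a i) h)).re := by
      rw [map_sum, sum_apply, inner_sum, Complex.re_sum]
      refine Finset.sum_congr rfl fun i _ => ?_
      rw [map_mul, map_star, ContinuousLinearMap.star_eq_adjoint]
      change _ = (inner ℂ h ((π (a i)).adjoint (π (a i) h))).re
      rw [ContinuousLinearMap.adjoint_inner_right]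
      exact (inner_self_eq_norm_sq (𝕜 := ℂ) (π (a i) h)).symm
    rw [e]
    refine (Complex.re_le_norm _).trans ((norm_inner_le_norm _ _).trans ?_)
    have := (π (∑ i, star (a i) * a i)).le_opNorm h
    rw [hiso] at this
    calc ‖h‖ * ‖π (∑ i, star (a i) * a i) h‖ ≤ ‖h‖ * (‖∑ i, star (a i) * a i‖ * ‖h‖) := by gcongr
      _ = _ := by ring
  calc ‖π (∑ i, c i • a i) h‖ ^ 2 ≤ (∑ i, ‖c i‖ * ‖π (a i) h‖) ^ 2 := by gcongr
    _ ≤ (∑ i, ‖c i‖ ^ 2) * ∑ i, ‖π (a i) h‖ ^ 2 := Finset.sum_mul_sq_le_sq_mul_sq _ _ _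
    _ ≤ (∑ i, ‖c i‖ ^ 2) * (‖∑ i, star (a i) * a i‖ * ‖h‖ ^ 2) := by gcongr
    _ = (√((∑ i, ‖c i‖ ^ 2) * ‖∑ i, star (a i) * a i‖) * ‖h‖) ^ 2 := by
      rw [mul_pow, Real.sq_sqrt (by positivity)]; ring

/-- Evaluate `ω` at `Σ conj(ω(aᵢ)) aᵢ`, where its value is the sum in question, and bound the norm
by Cauchy–Schwarz. This inequality keeps the gauge below finite. -/
lemma sum_norm_apply_sq_le (π : A →⋆ₙₐ[ℂ] (H →L[ℂ] H)) (hπ : Function.Injective π)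
    {ω : A →L[ℂ] ℂ} (hω : ‖ω‖ ≤ 1) {n : ℕ} (a : Fin n → A) :
    ∑ i, ‖ω (a i)‖ ^ 2 ≤ ‖∑ i, star (a i) * a i‖ := by
  set s := ∑ i, ‖ω (a i)‖ ^ 2 with hs
  have hs0 : 0 ≤ s := Finset.sum_nonneg fun _ _ => sq_nonneg _
  have h1 : ω (∑ i, star (ω (a i)) • a i) = (s : ℂ) := by
    rw [map_sum, hs, Complex.ofReal_sum]
    refine Finset.sum_congr rfl fun i _ => ?_
    rw [map_smul, smul_eq_mul, RCLike.star_def, Complex.conj_mul']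
    norm_cast
  have h2 : s ≤ ‖∑ i, star (ω (a i)) • a i‖ := by
    have := ω.le_of_opNorm_le hω (∑ i, star (ω (a i)) • a i)
    rwa [h1, Complex.norm_real, Real.norm_of_nonneg hs0, one_mul] at this
  have h3 := norm_sum_smul_sq_le π hπ (fun i => star (ω (a i))) a
  simp only [norm_star] at h3
  have h4 : s * s ≤ s * ‖∑ i, star (a i) * a i‖ := by
    refine le_trans ?_ h3
    rw [← sq]
    exact pow_le_pow_left₀ hs0 h2 2
  rcases eq_or_lt_of_le hs0 with h0 | h0
  · rw [← h0]; exact norm_nonneg _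
  · exact le_of_mul_le_mul_left h4 h0

/-- The values `‖x + Σ aᵢ* aᵢ‖ - Σ |ω(aᵢ)|²`. -/
def majorantValues (ω : A →L[ℂ] ℂ) (x : A) : Set ℝ :=
  {r | ∃ (n : ℕ) (a : Fin n → A), r = ‖x + ∑ i, star (a i) * a i‖ - ∑ i, ‖ω (a i)‖ ^ 2}

/-- The sublinear functional whose linear minorants give the majorants of `ω`. -/
def majorantGauge (ω : A →L[ℂ] ℂ) (x : A) : ℝ := sInf (majorantValues ω x)

lemma majorantValues_nonempty (ω : A →L[ℂ] ℂ) (x : A) : (majorantValues ω x).Nonempty :=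
  ⟨_, 0, Fin.elim0, rfl⟩

lemma neg_norm_le_of_mem_majorantValues (π : A →⋆ₙₐ[ℂ] (H →L[ℂ] H)) (hπ : Function.Injective π)
    {ω : A →L[ℂ] ℂ} (hω : ‖ω‖ ≤ 1) (x : A) {r : ℝ} (hr : r ∈ majorantValues ω x) : -‖x‖ ≤ r := by
  obtain ⟨n, a, rfl⟩ := hr
  have h1 := sum_norm_apply_sq_le π hπ hω a
  have h2 := norm_le_add_norm_add' x (∑ i, star (a i) * a i)
  linarith

lemma exists_real_majorant (π : A →⋆ₙₐ[ℂ] (H →L[ℂ] H)) (hπ : Function.Injective π)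
    {ω : A →L[ℂ] ℂ} (hω : ‖ω‖ ≤ 1) :
    ∃ f : A →ₗ[ℝ] ℝ, (∀ x, f x ≤ ‖x‖) ∧ ∀ a, ‖ω a‖ ^ 2 ≤ f (star a * a) := by
  have hbdd : ∀ x, BddBelow (majorantValues ω x) := fun x =>
    ⟨-‖x‖, fun r hr => neg_norm_le_of_mem_majorantValues π hπ hω x hr⟩
  have hsmul : ∀ c : ℝ, 0 < c → ∀ x, ∀ r ∈ majorantValues ω x,
      c * r ∈ majorantValues ω (c • x) := by
    rintro c hc x _ ⟨n, a, rfl⟩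
    have hsq : ((√c : ℝ) : ℂ) * ((√c : ℝ) : ℂ) = (c : ℂ) := by
      rw [← Complex.ofReal_mul, Real.mul_self_sqrt hc.le]
    refine ⟨n, fun i => ((√c : ℝ) : ℂ) • a i, ?_⟩
    have e1 : c • x + ∑ i, star (((√c : ℝ) : ℂ) • a i) * (((√c : ℝ) : ℂ) • a i)
        = c • (x + ∑ i, star (a i) * a i) := by
      rw [smul_add, Finset.smul_sum]
      congr 1
      refine Finset.sum_congr rfl fun i _ => ?_
      rw [star_smul, smul_mul_smul_comm, RCLike.star_def, Complex.conj_ofReal, hsq]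
      exact Complex.coe_smul c _
    have e2 : ∑ i, ‖ω (((√c : ℝ) : ℂ) • a i)‖ ^ 2 = c * ∑ i, ‖ω (a i)‖ ^ 2 := by
      rw [Finset.mul_sum]
      refine Finset.sum_congr rfl fun i _ => ?_
      rw [map_smul, norm_smul, mul_pow, Complex.norm_real, Real.norm_of_nonneg (Real.sqrt_nonneg _),
        Real.sq_sqrt hc.le]
    rw [e1, e2, norm_smul, Real.norm_of_nonneg hc.le]
    ring
  have hle : ∀ c : ℝ, 0 < c → ∀ x, majorantGauge ω (c • x) ≤ c * majorantGauge ω x := by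
    intro c hc x
    rw [← div_le_iff₀' hc]
    refine le_csInf (majorantValues_nonempty ω x) fun r hr => ?_
    rw [div_le_iff₀' hc]
    exact csInf_le (hbdd _) (hsmul c hc x r hr)
  -- The zero functional on the zero subspace is extended; domination there only says that the gauge
  -- is nonnegative at zero.
  obtain ⟨f, -, hf⟩ := exists_extension_of_le_sublinear (E := A) ⟨⊥, 0⟩ (majorantGauge ω)
    (fun c hc x => by
      refine le_antisymm (hle c hc x) ?_
      have := hle c⁻¹ (inv_pos.mpr hc) (c • x)
      rw [smul_smul, inv_mul_cancel₀ hc.ne', one_smul] at this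
      rwa [← le_inv_mul_iff₀ hc])
    (fun x y => by
      have h1 : ∀ r ∈ majorantValues ω x, ∀ r' ∈ majorantValues ω y,
          majorantGauge ω (x + y) ≤ r + r' := by
        rintro _ ⟨n, a, rfl⟩ _ ⟨m, b, rfl⟩
        refine (csInf_le (hbdd _) ⟨n + m, Fin.append a b, rfl⟩).trans ?_
        rw [Fin.sum_univ_add, Fin.sum_univ_add]
        simp only [Fin.append_left, Fin.append_right]
        have h2 := norm_add_le (x + ∑ i, star (a i) * a i) (y + ∑ i, star (b i) * b i)
        rw [add_add_add_comm] at h2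
        linarith
      have h2 : ∀ r ∈ majorantValues ω x, majorantGauge ω (x + y) - r ≤ majorantGauge ω y :=
        fun r hr => le_csInf (majorantValues_nonempty ω y) fun r' hr' => by
          linarith [h1 r hr r' hr']
      have h3 : majorantGauge ω (x + y) - majorantGauge ω y ≤ majorantGauge ω x :=
        le_csInf (majorantValues_nonempty ω x) fun r hr => by linarith [h2 r hr]
      linarith)
    (fun x => by
      have hx : (x : A) = 0 := (Submodule.mem_bot ℝ).mp x.2
      rw [hx]
      refine le_csInf (majorantValues_nonempty ω 0) fun r hr => ?_
      have := neg_norm_le_of_mem_majorantValues π hπ hω 0 hr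
      simpa using this)
  refine ⟨f, fun x => (hf x).trans ?_, fun a => ?_⟩
  · refine csInf_le (hbdd x) ⟨0, Fin.elim0, by simp⟩
  -- The one-element family `a` at the point `-a* a` cancels the norm term and leaves `-|ω(a)|²`.
  · have h1 : f (-(star a * a)) ≤ -‖ω a‖ ^ 2 :=
      (hf _).trans (csInf_le (hbdd _) ⟨1, fun _ => a, by simp⟩)
    rw [map_neg] at h1
    linarith

variable [PartialOrder A] [StarOrderedRing A]

/-- Every contractive functional on a `C*`-algebra has a majorant. -/
theorem exists_isMajorant (π : A →⋆ₙₐ[ℂ] (H →L[ℂ] H)) (hπ : Function.Injective π)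
    {ω : A →L[ℂ] ℂ} (hω : ‖ω‖ ≤ 1) : ∃ φ, IsMajorant φ ω := by
  obtain ⟨f, hf, hfω⟩ := exists_real_majorant π hπ hω
  -- Averaging over the involution does not change the value on `a* a`, and it makes the
  -- complexified functional real on such elements, hence positive.
  let g : Module.Dual ℝ A :=
    { toFun := fun x => (f x + f (star x)) / 2
      map_add' := fun x y => by simp only [star_add, map_add]; ring
      map_smul' := fun c x => by
        have : star (c • x) = c • star x := by rw [star_smul, star_trivial]
        simp only [this, map_smul, smul_eq_mul, RingHom.id_apply]; ring }
  have hg_apply : ∀ x, g x = (f x + f (star x)) / 2 := fun x => rfl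
  have hg : ∀ x, |g x| ≤ ‖x‖ := by
    have h1 : ∀ x, g x ≤ ‖x‖ := fun x => by
      have h2 := hf (star x)
      rw [norm_star] at h2
      rw [hg_apply]
      linarith [hf x]
    intro x
    have h2 := h1 (-x)
    rw [map_neg, norm_neg] at h2
    exact abs_le.mpr ⟨by linarith, h1 x⟩
  let φ : A →L[ℂ] ℂ := (g.extendRCLike (𝕜 := ℂ)).mkContinuous 1 fun x => by
    rw [one_mul]
    exact g.norm_extendRCLike_le_seminorm (p := normSeminorm ℂ A) hg x
  have hre : ∀ x, (φ x).re = g x := fun x => Module.Dual.re_extendRCLike_apply (𝕜 := ℂ) g x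
  have him : ∀ x, (φ x).im = -g (Complex.I • x) := fun x =>
    Module.Dual.im_extendRCLike_apply (𝕜 := ℂ) g x
  have hb : ∀ a, ‖ω a‖ ^ 2 ≤ (φ (star a * a)).re := fun a => by
    rw [hre, hg_apply, star_mul, star_star]
    linarith [hfω a]
  refine ⟨φ, fun x hx => ?_, LinearMap.mkContinuous_norm_le _ zero_le_one _, hb⟩
  obtain ⟨a, rfl⟩ := CStarAlgebra.nonneg_iff_eq_star_mul_self.mp hx
  refine Complex.nonneg_iff.mpr ⟨(sq_nonneg _).trans (hb a), ?_⟩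
  rw [him, hg_apply, star_smul, star_mul, star_star, RCLike.star_def, Complex.conj_I, neg_smul,
    map_neg]
  simp

end MajorantExistence

/-! ### Kadison–Schwarz inequality for slices -/

section KadisonSchwarz

variable {A H : Type*} [NonUnitalCStarAlgebra A]
  [NormedAddCommGroup H] [InnerProductSpace ℂ H] [CompleteSpace H]
  (π : A →⋆ₙₐ[ℂ] (H →L[ℂ] H))

/-- The element `S* T` of `A ⊗ A`. -/
def adjMul (S T : spatialTensor π) : spatialTensor π := leftMul π (toMultiplier π (adjTensor π S)) T

@[simp] lemma coe_adjMul (S T : spatialTensor π) :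
    (adjMul π S T : HilbertTensor H H →L[ℂ] HilbertTensor H H) = star S.1 * T.1 := rfl

/-- The form `μ((φ ⊗ id)(S* T)) - μ((ω ⊗ id)(S)* (ω ⊗ id)(T))`. -/
def sliceDefect (φ ω μ : A →L[ℂ] ℂ) : spatialTensor π →ₗ⋆[ℂ] spatialTensor π →ₗ[ℂ] ℂ :=
  LinearMap.mk₂'ₛₗ (starRingEnd ℂ) (RingHom.id ℂ)
    (fun S T => μ (slice π φ (adjMul π S T)) - μ (star (slice π ω S) * slice π ω T))
    (fun S S' T => by
      have e : adjMul π (S + S') T = adjMul π S T + adjMul π S' T :=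
        Subtype.ext (by simp [add_mul])
      simp only [e, map_add, star_add, add_mul]; ring)
    (fun z S T => by
      have e : adjMul π (z • S) T = (starRingEnd ℂ) z • adjMul π S T :=
        Subtype.ext (by simp)
      simp only [e, map_smul, star_smul, smul_mul_assoc, smul_eq_mul, RCLike.star_def]; ring)
    (fun S T T' => by
      simp only [adjMul, map_add, mul_add]; ring)
    (fun z S T => by
      simp only [adjMul, map_smul, mul_smul_comm, smul_eq_mul, RingHom.id_apply]; ring)

lemma sliceDefect_apply (φ ω μ : A →L[ℂ] ℂ) (S T : spatialTensor π) :
    sliceDefect π φ ω μ S T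
      = μ (slice π φ (adjMul π S T)) - μ (star (slice π ω S) * slice π ω T) := rfl

/-- The defect factors into two forms, one per leg; positivity on `A ⊗ A` thereby becomes the Schur
product theorem. -/
lemma sliceDefect_elemTensor (hπ : Function.Injective π) (φ ω μ : A →L[ℂ] ℂ) (a c b d : A) :
    sliceDefect π φ ω μ (elemTensor π a c) (elemTensor π b d)
      = defectForm φ ω a b * gnsForm μ c d := by
  have e : adjMul π (elemTensor π a c) (elemTensor π b d) = elemTensor π (star a * b) (star c * d) :=
    Subtype.ext (by simp [star_opTensor, opTensor_mul, map_star])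
  rw [sliceDefect_apply, e, slice_elemTensor π hπ, slice_elemTensor π hπ, slice_elemTensor π hπ,
    defectForm_apply, gnsForm_apply, map_smul, star_smul, smul_mul_smul_comm, map_smul, smul_eq_mul,
    smul_eq_mul]
  ring

variable [PartialOrder A] [StarOrderedRing A]

/-- The Kadison–Schwarz inequality `(ω ⊗ id)(T)* (ω ⊗ id)(T) ≤ (φ ⊗ id)(T* T)`, tested on a
positive functional. -/
lemma sliceDefect_nonneg (hπ : Function.Injective π) {φ ω μ : A →L[ℂ] ℂ} (h : IsMajorant φ ω)
    (hμ : IsPositiveFunctional μ) (T : spatialTensor π) : 0 ≤ sliceDefect π φ ω μ T T := by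
  refine (denseRange_algTensor π).induction_on T ?_ fun t => ?_
  · refine isClosed_le continuous_const ?_
    have c1 : Continuous fun T => adjMul π T T :=
      Continuous.subtype_mk ((continuous_star.comp continuous_subtype_val).mul
        continuous_subtype_val) _
    have c2 : Continuous fun T => star (slice π ω T) * slice π ω T :=
      (continuous_star.comp (slice π ω).continuous).mul (slice π ω).continuous
    exact (μ.continuous.comp ((slice π φ).continuous.comp c1)).sub (μ.continuous.comp c2)
  · obtain ⟨n, a, c, rfl⟩ := TensorProduct.exists_sum_tmul_eq t
    have e : ∀ i, algTensor π (a i ⊗ₜ c i) = elemTensor π (a i) (c i) := fun i => rfl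
    simp only [map_sum, LinearMap.sum_apply, e, sliceDefect_elemTensor π hπ]
    rw [Finset.sum_comm]
    exact sum_mul_gram_nonneg _ h.defectForm_nonneg _ (gnsForm_nonneg hμ) a c

end KadisonSchwarz

/-! ### Contractive idempotents: the Kadison–Schwarz inequality and its equality case. -/

namespace CancellativeComultiplication

lemma adjMul_comulRight {A H : Type*} [NonUnitalCStarAlgebra A]
    [NormedAddCommGroup H] [InnerProductSpace ℂ H] [CompleteSpace H]
    (G : CancellativeComultiplication A H) (a u : A) :
    adjMul G.π (G.comulRight a u) (G.comulRight a u)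
      = leftMul G.π (oneTensor G.π (star u)) (G.comulRight (star a * a) u) :=
  Subtype.ext (by simp [star_opTensor, map_star, mul_assoc])

section Idempotent

open Filter Topology

variable {A H : Type*} [NonUnitalCStarAlgebra A] [PartialOrder A] [StarOrderedRing A]
  [NormedAddCommGroup H] [InnerProductSpace ℂ H] [CompleteSpace H]
  (G : CancellativeComultiplication A H)

lemma sliceDefect_comulRight (φ ω μ : A →L[ℂ] ℂ) (a u : A) :
    sliceDefect G.π φ ω μ (G.comulRight a u) (G.comulRight a u)
      = μ (star u * (G.leftConv φ (star a * a) - star (G.leftConv ω a) * G.leftConv ω a) * u) := by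
  rw [sliceDefect_apply, adjMul_comulRight, slice_leftMul_oneTensor G.π G.π_injective,
    slice_comulRight, slice_comulRight, ← map_sub]
  congr 1
  rw [star_mul]
  noncomm_ring

/-- `Δ(a)` is only a multiplier, so the defect form is evaluated at `Δ(a)(1 ⊗ u)`; the approximate
unit then removes the compression by `u`. -/
lemma tendsto_sliceDefect_comulRight (φ ω μ : A →L[ℂ] ℂ) (a : A) :
    Tendsto (fun u => sliceDefect G.π φ ω μ (G.comulRight a u) (G.comulRight a u))
      (CStarAlgebra.approximateUnit A)
      (𝓝 (μ (G.leftConv φ (star a * a)) - μ (star (G.leftConv ω a) * G.leftConv ω a))) := by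
  have hl := CStarAlgebra.increasingApproximateUnit A
  set x := G.leftConv φ (star a * a) - star (G.leftConv ω a) * G.leftConv ω a with hx
  have h1 : Tendsto (fun u => star u * x * u) (CStarAlgebra.approximateUnit A) (𝓝 x) := by
    have h2 : Tendsto (fun u => u * x) (CStarAlgebra.approximateUnit A) (𝓝 x) :=
      hl.tendsto_mul_right x
    have h3 : Tendsto (fun u => (u * x - x) * u) (CStarAlgebra.approximateUnit A) (𝓝 0) := by
      have h4 : Tendsto (fun u => u * x - x) (CStarAlgebra.approximateUnit A) (𝓝 0) := by
        simpa using h2.sub_const x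
      refine h4.zero_mul_isBoundedUnder_le ?_
      exact isBoundedUnder_of_eventually_le (a := 1) hl.eventually_norm
    have h5 := h3.add (hl.tendsto_mul_left x)
    rw [zero_add] at h5
    refine h5.congr' ?_
    filter_upwards [hl.eventually_star_eq] with u hu
    rw [hu, sub_mul, sub_add_cancel]
  rw [← map_sub]
  refine ((μ.continuous.tendsto _).comp h1).congr fun u => ?_
  rw [sliceDefect_comulRight]
  rfl

lemma apply_star_leftConv_mul_leftConv_le {φ ω μ : A →L[ℂ] ℂ} (h : IsMajorant φ ω)
    (hμ : IsPositiveFunctional μ) (a : A) :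
    μ (star (G.leftConv ω a) * G.leftConv ω a) ≤ μ (G.leftConv φ (star a * a)) := by
  rw [← sub_nonneg]
  exact ge_of_tendsto (G.tendsto_sliceDefect_comulRight φ ω μ a)
    (Eventually.of_forall fun u => sliceDefect_nonneg G.π G.π_injective h hμ _)

/-- Kadison–Schwarz with `ω = φ`, since a positive contraction is its own majorant. -/
lemma isPositiveFunctional_conv {φ : A →L[ℂ] ℂ} (hφ : IsPositiveFunctional φ) (h1 : ‖φ‖ ≤ 1) :
    IsPositiveFunctional (G.conv φ φ) := fun x hx => by
  obtain ⟨a, rfl⟩ := CStarAlgebra.nonneg_iff_eq_star_mul_self.mp hx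
  exact (hφ _ (star_mul_self_nonneg _)).trans
    (G.apply_star_leftConv_mul_leftConv_le (hφ.isMajorant_self h1) hφ a)

/-- `ω` is a nonzero contractive idempotent. -/
structure IsContractiveIdem (ω : A →L[ℂ] ℂ) : Prop where
  norm_eq : ‖ω‖ = 1
  idem : G.conv ω ω = ω

variable {G}

lemma IsContractiveIdem.apply_leftConv {ω : A →L[ℂ] ℂ} (hω : G.IsContractiveIdem ω) (a : A) :
    ω (G.leftConv ω a) = ω a := congrArg (fun f => f a) hω.idem

lemma IsContractiveIdem.leftConv_leftConv {ω : A →L[ℂ] ℂ} (hω : G.IsContractiveIdem ω) (a : A) :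
    G.leftConv ω (G.leftConv ω a) = G.leftConv ω a := by
  rw [G.leftConv_leftConv, hω.idem]

/-- `φ ⋆ φ` is another majorant: `|ω(a)|² = |ω(L_ω(a))|² ≤ φ(L_ω(a)* L_ω(a)) ≤ (φ ⋆ φ)(a* a)`.
Uniqueness finishes. -/
lemma IsContractiveIdem.conv_majorant {φ ω : A →L[ℂ] ℂ} (hω : G.IsContractiveIdem ω)
    (h : IsMajorant φ ω) : G.conv φ φ = φ := by
  refine IsMajorant.unique (ω := ω) ⟨G.isPositiveFunctional_conv h.pos h.norm_le, ?_, fun a => ?_⟩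
    h hω.norm_eq
  · exact (G.norm_conv_le φ φ).trans (mul_le_one₀ h.norm_le (norm_nonneg _) h.norm_le)
  · rw [← hω.apply_leftConv]
    refine (h.bound _).trans ?_
    exact (Complex.le_def.mp (G.apply_star_leftConv_mul_leftConv_le h h.pos a)).1

lemma IsContractiveIdem.majorant {φ ω : A →L[ℂ] ℂ} (hω : G.IsContractiveIdem ω)
    (h : IsMajorant φ ω) : G.IsContractiveIdem φ :=
  ⟨h.norm_eq hω.norm_eq, hω.conv_majorant h⟩

lemma IsContractiveIdem.starFunctional {ω : A →L[ℂ] ℂ} (hω : G.IsContractiveIdem ω) :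
    G.IsContractiveIdem (starFunctional ω) where
  norm_eq := by
    refine le_antisymm ((norm_starFunctional_le ω).trans_eq hω.norm_eq) ?_
    have := norm_starFunctional_le (_root_.starFunctional ω)
    rwa [starFunctional_starFunctional, hω.norm_eq] at this
  idem := ContinuousLinearMap.ext fun a => by
    change _root_.starFunctional ω (G.leftConv (_root_.starFunctional ω) a) = _
    rw [leftConv_starFunctional, starFunctional_apply, star_star, hω.apply_leftConv,
      starFunctional_apply]

/-- For `y` in the range of `L_ω`, the operators `Δ(y)` and `1 ⊗ y` agree after slicing. -/
lemma IsContractiveIdem.apply_slice_rightMul_comul {φ ω : A →L[ℂ] ℂ} (hω : G.IsContractiveIdem ω)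
    (h : IsMajorant φ ω) {y : A} (hy : G.leftConv ω y = y) (T : spatialTensor G.π) :
    φ (slice G.π φ (rightMul G.π (G.Δ y) T)) = φ (slice G.π (_root_.starFunctional ω) T * y) := by
  have hl := CStarAlgebra.increasingApproximateUnit A
  set s := sliceDefect G.π φ ω φ
  have hs : ∀ S, 0 ≤ s S S := sliceDefect_nonneg G.π G.π_injective h h.pos
  set x := slice G.π φ (rightMul G.π (G.Δ y) T) - slice G.π (_root_.starFunctional ω) T * y with hx
  -- Equality case: the limit is `φ(L_φ(y* y)) - φ(y* y)`, which is zero because `φ` is idempotent.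
  have h0 : Tendsto (fun u => (s (G.comulRight y u) (G.comulRight y u)).re)
      (CStarAlgebra.approximateUnit A) (𝓝 0) := by
    have h1 := (Complex.continuous_re.tendsto _).comp (G.tendsto_sliceDefect_comulRight φ ω φ y)
    have h2 : φ (G.leftConv φ (star y * y)) = φ (star y * y) :=
      congrArg (fun f => f (star y * y)) (hω.conv_majorant h)
    rw [h2, hy, sub_self, Complex.zero_re] at h1
    exact h1
  have h1 : ∀ u, s (adjTensor G.π T) (G.comulRight y u) = φ (x * u) := fun u => by
    have e : adjMul G.π (adjTensor G.π T) (G.comulRight y u)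
        = rightMul G.π (oneTensor G.π u) (rightMul G.π (G.Δ y) T) :=
      Subtype.ext (by simp [mul_assoc])
    rw [sliceDefect_apply, e, slice_rightMul_oneTensor G.π G.π_injective, slice_comulRight, hy,
      ← slice_starFunctional G.π G.π_injective, ← map_sub, hx, sub_mul, mul_assoc _ y u]
  have h2 : Tendsto (fun u => ‖φ (x * u)‖ ^ 2) (CStarAlgebra.approximateUnit A)
      (𝓝 (‖φ x‖ ^ 2)) :=
    (((φ.continuous.tendsto _).comp (hl.tendsto_mul_left x)).norm).pow 2
  have h3 : ‖φ x‖ ^ 2 ≤ (s (adjTensor G.π T) (adjTensor G.π T)).re * 0 := by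
    refine le_of_tendsto_of_tendsto' h2 (h0.const_mul _) fun u => ?_
    rw [← h1]
    exact sesquilinear_cauchy_schwarz s hs _ _
  rw [mul_zero] at h3
  have h4 : φ x = 0 := norm_eq_zero.mp
    (pow_eq_zero_iff two_ne_zero |>.mp (le_antisymm h3 (sq_nonneg _)))
  rw [hx, map_sub, sub_eq_zero] at h4
  exact h4

/-- `φ(b L_ω(d)) = conj ω(b*) ω(d)` for the majorant `φ` of a contractive idempotent `ω`. -/
lemma IsContractiveIdem.majorant_mul_leftConv {φ ω : A →L[ℂ] ℂ} (hω : G.IsContractiveIdem ω)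
    (h : IsMajorant φ ω) (b d : A) :
    φ (b * G.leftConv ω d) = _root_.starFunctional ω b * ω d := by
  -- The claim is exactly that `ν` vanishes at `d`.
  set ν := G.conv ω (leftMulFunctional φ b) - _root_.starFunctional ω b • ω with hν
  have h1 : ∀ c a, φ (c * G.leftConv ν a) = 0 := fun c a => by
    have h2 := hω.apply_slice_rightMul_comul h (hω.leftConv_leftConv a) (elemTensor G.π b c)
    rw [slice_leftMul_comul, slice_elemTensor G.π G.π_injective, G.leftConv_leftConv,
      smul_mul_assoc, map_smul] at h2
    rw [hν, leftConv_sub_functional, leftConv_smul_functional, sub_apply, mul_sub, map_sub, h2,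
      smul_apply, mul_smul_comm, map_smul, sub_self]
  -- Since the `(1 ⊗ c)Δ(a)` are total, `φ ∘ (ν ⊗ id)` vanishes on all of `A ⊗ A`; at `d ⊗ e` this
  -- reads `ν(d) φ(e) = 0`.
  have h2 : φ ∘L slice G.π ν = 0 := G.clm_ext_comulLeft fun c a => by
    rw [ContinuousLinearMap.comp_apply, slice_comulLeft, h1, zero_apply]
  obtain ⟨e, he⟩ : ∃ e, φ e ≠ 0 := by
    by_contra! hc
    have : φ = 0 := ContinuousLinearMap.ext hc
    have h3 := h.norm_eq hω.norm_eq
    rw [this, norm_zero] at h3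
    exact zero_ne_one h3
  have h3 := congrArg (fun f => f (elemTensor G.π d e)) h2
  simp only [ContinuousLinearMap.comp_apply, slice_elemTensor G.π G.π_injective, map_smul,
    smul_eq_mul, zero_apply, mul_eq_zero, he, or_false] at h3
  rw [hν, sub_apply, sub_eq_zero] at h3
  exact h3

/-- Lifts a scalar identity to convolution operators. Coassociativity gives the identity of slices
for `(b ⊗ c)Δ(L_μ(a))`; by density `b ⊗ c` may be replaced by `(1 ⊗ c)Δ(b)`, and `Δ` is
multiplicative. -/
lemma leftConv_mul_leftConv {ν μ κ : A →L[ℂ] ℂ}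
    (h : ∀ b d, ν (b * G.leftConv μ d) = κ b * μ d) (b a : A) :
    G.leftConv ν (b * G.leftConv μ a) = G.leftConv κ b * G.leftConv μ a := by
  have h1 : slice G.π ν ∘L rightMul G.π (G.Δ (G.leftConv μ a))
      = (ContinuousLinearMap.mul ℂ A).flip (G.leftConv μ a) ∘L slice G.π κ := by
    refine spatialTensor_clm_ext G.π fun b c => ?_
    have h2 : G.conv μ (leftMulFunctional ν b) = κ b • μ :=
      ContinuousLinearMap.ext fun d => h b d
    simp only [ContinuousLinearMap.comp_apply, slice_leftMul_comul, G.leftConv_leftConv, h2,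
      leftConv_smul_functional, slice_elemTensor G.π G.π_injective, smul_apply,
      ContinuousLinearMap.flip_apply, ContinuousLinearMap.mul_apply', smul_mul_assoc,
      mul_smul_comm]
  have h3 : ∀ c, c * G.leftConv ν (b * G.leftConv μ a)
      = c * (G.leftConv κ b * G.leftConv μ a) := fun c => by
    have h4 := congrArg (fun f => f (G.comulLeft c b)) h1
    have e : rightMul G.π (G.Δ (G.leftConv μ a)) (G.comulLeft c b)
        = G.comulLeft c (b * G.leftConv μ a) := Subtype.ext (by simp [mul_assoc])
    simp only [ContinuousLinearMap.comp_apply, e, slice_comulLeft,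
      ContinuousLinearMap.flip_apply, ContinuousLinearMap.mul_apply'] at h4
    rw [h4, mul_assoc]
  refine star_injective (eq_of_forall_mul_eq fun c => star_injective ?_)
  simpa using h3 (star c)

/-- `L_φ(b L_ω(a)) = L_ω(b*)* L_ω(a)`. -/
lemma IsContractiveIdem.leftConv_majorant_mul {φ ω : A →L[ℂ] ℂ} (hω : G.IsContractiveIdem ω)
    (h : IsMajorant φ ω) (b a : A) :
    G.leftConv φ (b * G.leftConv ω a) = star (G.leftConv ω (star b)) * G.leftConv ω a := by
  rw [leftConv_mul_leftConv (hω.majorant_mul_leftConv h), leftConv_starFunctional]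

/-- `L_ω(b L_φ(a)) = L_ω(b) L_φ(a)`. -/
lemma IsContractiveIdem.leftConv_mul_majorant {φ ω : A →L[ℂ] ℂ} (hω : G.IsContractiveIdem ω)
    (h : IsMajorant φ ω) (b a : A) :
    G.leftConv ω (b * G.leftConv φ a) = G.leftConv ω b * G.leftConv φ a := by
  refine leftConv_mul_leftConv (fun b d => ?_) b a
  obtain ⟨e, he⟩ := exists_isNorming hω.norm_eq
  -- Writing `ω` as the limit of `φ(eₙ* ·)` reduces to the product formula for `φ`, viewed as its
  -- own majorant.
  refine tendsto_nhds_unique (h.tendsto_left he _) ?_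
  refine ((h.tendsto_left he b).mul_const (φ d)).congr fun n => ?_
  rw [← mul_assoc, (hω.majorant h).majorant_mul_leftConv (h.pos.isMajorant_self h.norm_le),
    h.pos.starFunctional_eq]

/-- `L_ω(L_ω(a) b) = L_ω(a) L_φ(b)`. -/
lemma IsContractiveIdem.leftConv_leftConv_mul {φ ω : A →L[ℂ] ℂ} (hω : G.IsContractiveIdem ω)
    (h : IsMajorant φ ω) (a b : A) :
    G.leftConv ω (G.leftConv ω a * b) = G.leftConv ω a * G.leftConv φ b := by
  -- A majorant of `ω^*` is needed as well: `φ'(eₙ ·)` tends to `ω^*`, while `ω(eₙ ·)` tends to `φ`.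
  -- The result is then the adjoint of an identity for `ω^*`.
  obtain ⟨φ', h'⟩ := exists_isMajorant G.π G.π_injective hω.starFunctional.norm_eq.le
  obtain ⟨e, he⟩ := exists_isNorming hω.norm_eq
  have h1 : ∀ b d, _root_.starFunctional ω (b * G.leftConv (_root_.starFunctional ω) d)
      = φ b * _root_.starFunctional ω d := fun b d => by
    refine tendsto_nhds_unique (h'.tendsto_left he.star _) ?_
    refine ((h.tendsto_right he b).mul_const (_root_.starFunctional ω d)).congr fun n => ?_
    rw [star_star, ← mul_assoc, hω.starFunctional.majorant_mul_leftConv h',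
      starFunctional_starFunctional]
  have h2 := leftConv_mul_leftConv h1 (star b) (star a)
  rw [← h.pos.starFunctional_eq] at h2
  simp only [leftConv_starFunctional, star_mul, star_star] at h2
  exact (star_injective (by simpa using h2))

/-- `L_ω(a x* y) = L_ω(a) x* y` for `x, y` in the range of `L_ω`. -/
lemma IsContractiveIdem.leftConv_mul_star_mul {ω : A →L[ℂ] ℂ} (hω : G.IsContractiveIdem ω)
    (a x y : A) :
    G.leftConv ω (a * star (G.leftConv ω x) * G.leftConv ω y)
      = G.leftConv ω a * star (G.leftConv ω x) * G.leftConv ω y := by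
  obtain ⟨φ, h⟩ := exists_isMajorant G.π G.π_injective hω.norm_eq.le
  -- Products `x* y` of elements of the range of `L_ω` lie in the range of `L_φ`, over which `L_ω`
  -- is a right module map.
  have e : star (G.leftConv ω x) * G.leftConv ω y = G.leftConv φ (star x * G.leftConv ω y) := by
    rw [hω.leftConv_majorant_mul h, star_star]
  rw [mul_assoc, e, hω.leftConv_mul_majorant h, ← e, mul_assoc]

/-- `L_ω(x y* a) = x y* L_ω(a)` for `x, y` in the range of `L_ω`. -/
lemma IsContractiveIdem.leftConv_mul_star_mul' {ω : A →L[ℂ] ℂ} (hω : G.IsContractiveIdem ω)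
    (x y a : A) :
    G.leftConv ω (G.leftConv ω x * star (G.leftConv ω y) * a)
      = G.leftConv ω x * star (G.leftConv ω y) * G.leftConv ω a := by
  have h := hω.starFunctional.leftConv_mul_star_mul (star a) (star y) (star x)
  simp only [leftConv_starFunctional, star_star, star_mul] at h
  refine star_injective ?_
  simpa [mul_assoc] using h

/-- `L_ω(x a* y) = x L_ω(a)* y` for `x, y` in the range of `L_ω`. -/
lemma IsContractiveIdem.leftConv_mul_star_mul_middle {ω : A →L[ℂ] ℂ}
    (hω : G.IsContractiveIdem ω) (x a y : A) :
    G.leftConv ω (G.leftConv ω x * star a * G.leftConv ω y)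
      = G.leftConv ω x * star (G.leftConv ω a) * G.leftConv ω y := by
  obtain ⟨φ, h⟩ := exists_isMajorant G.π G.π_injective hω.norm_eq.le
  rw [mul_assoc, hω.leftConv_leftConv_mul h, hω.leftConv_majorant_mul h, star_star, mul_assoc]

end Idempotent

end CancellativeComultiplication

end

theorem mainTheorem3 {A H : Type*} [NonUnitalCStarAlgebra A] [PartialOrder A] [StarOrderedRing A]
    [NormedAddCommGroup H] [InnerProductSpace ℂ H] [CompleteSpace H]
    (G : LocallyCompactQuantumGroup A H) (hG : G.IsCoamenable)
    (ω : A →L[ℂ] ℂ) (hω : G.IsContractiveIdempotent ω) :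
    IsTRO (G.imageSpace ω) ∧
      IsTROConditionalExpectation (G.imageSpace ω) (G.leftConv ω).toLinearMap := by
  have hω' : G.IsContractiveIdem ω := by
    refine ⟨le_antisymm hω.contractive ?_, hω.idempotent⟩
    -- Submultiplicativity gives `‖ω‖ ≤ ‖ω‖²`, so a nonzero `ω` has norm at least one.
    have h1 := G.norm_conv_le ω ω
    rw [hω.idempotent] at h1
    have h2 : 0 < ‖ω‖ := norm_pos_iff.mpr hω.ne_zero
    nlinarith
  have hmem : ∀ x ∈ G.imageSpace ω, G.leftConv ω x = x := by
    rintro _ ⟨x, rfl⟩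
    exact hω'.leftConv_leftConv x
  have hTRO : IsTRO (G.imageSpace ω) := by
    refine ⟨?_, fun a ha b hb c hc => ⟨a * star b * c, ?_⟩⟩
    -- The range of a continuous idempotent map is its fixed-point set, hence closed.
    · have : (G.imageSpace ω : Set A) = {x | G.leftConv ω x = x} :=
        Set.ext fun x => ⟨hmem x, fun hx => ⟨x, hx⟩⟩
      rw [this]
      exact isClosed_eq (G.leftConv ω).continuous continuous_id
    · have := hω'.leftConv_mul_star_mul a b c
      rw [hmem b hb, hmem c hc, hmem a ha] at this
      exact this
  refine ⟨hTRO, hTRO, rfl, hmem, fun a => ?_, ?_, ?_, ?_⟩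
  · exact (G.leftConv ω).le_of_opNorm_le ((G.norm_leftConv_le ω).trans hω.contractive) a |>.trans_eq
      (one_mul _)
  · intro a x hx y hy
    have := hω'.leftConv_mul_star_mul a x y
    rwa [hmem x hx, hmem y hy] at this
  · intro a x hx y hy
    have := hω'.leftConv_mul_star_mul_middle x a y
    rwa [hmem x hx, hmem y hy] at this
  · intro a x hx y hy
    have := hω'.leftConv_mul_star_mul' x y a
    rwa [hmem x hx, hmem y hy] at this
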